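/- There is an absolute constant $A$, and for every integer $d\ge 0$ a constant $C_d$ depending only on $d$, such that the following holds for all $\delta>0$ and $R\ge 1$; put $K=R^{\delta^2}$. Let $B_R\subset\mathbb{R}^3$ be a closed ball of radius $R$, and let $2B_R$ be the concentric ball of radius $2R$. Let $Z=\{P=0\}\subset\mathbb{R}^3$ be a smooth algebraic surface of degree at most $d$, i.e. $P$ is a real polynomial of degree at most $d$ with $\nabla P\neq 0$ at every point of $Z$. Let $S$ be the (closed) $R^{1/2+\delta}$-neighborhood of $Z$, intersected with $B_R$. A tube $T$ is a solid circular cylinder of length $R$ and radius $R^{1/2+\delta}$; its direction $G(T)$ is the direction of its axis, and $\lambda T$ is its dilate by $\lambda$ about its center. All angles, between lines or between a line and a plane, are taken in $[0,\pi/2]$. * $T$ is tangential to $S$ if $2T\cap Z\ne\emptyset$ and $\mathrm{Angle}(G(T),T_xZ)\le R^{-1/2+2\delta}$ for every $x\in Z\cap 10T\cap 2B_R$. * $T$ is tangential to $S$ in the essential sense if $T$ is tangential to $S$ and there is another tube $T'$, tangential to $S$, with $T\cap T'\cap S\neq\emptyset$ and $\mathrm{Angle}(G(T),G(T'))\ge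 K^{-1}$. * $T$ is $R^{-1/2+\delta}$-tangential to a plane $\Sigma$ if $\mathrm{Angle}(G(T),\Sigma)\le R^{-1/2+\delta}$ and $T$ is contained in the $2R^{1/2+\delta}$-neighborhood of $\Sigma$. Then for every direction $e$ there are at most $C_dR^{A\delta}$ planes such that every tube $T$ with direction $e$ that is tangential to $S$ in the essential sense is $R^{-1/2+\delta}$-tangential to at least one of these planes. -/

import Mathlib

noncomputable section

/-- Euclidean space `ℝ³`. -/
abbrev E3 : Type := EuclideanSpace ℝ (Fin 3)

/-- The angle in `[0, π/2]` between the lines spanned by two vectors. -/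
def lineAngle (u v : E3) : ℝ :=
  min (InnerProductGeometry.angle u v) (Real.pi - InnerProductGeometry.angle u v)

/-- The angle in `[0, π/2]` between a nonzero vector and a linear subspace: the angle between the
vector and its orthogonal projection (it is `π/2` when the projection vanishes). -/
def subspaceAngle (u : E3) (W : Submodule ℝ E3) : ℝ :=
  InnerProductGeometry.angle u (W.starProjection u)

/-- The real zero set `Z(P)` of a polynomial in three variables. -/
def zeroSurface (P : MvPolynomial (Fin 3) ℝ) : Set E3 :=
  {x | MvPolynomial.eval (fun i => x i) P = 0}

/-- The gradient of a polynomial. -/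
def polyGrad (P : MvPolynomial (Fin 3) ℝ) (x : E3) : E3 :=
  WithLp.toLp 2 fun i => MvPolynomial.eval (fun j => x j) (MvPolynomial.pderiv i P)

/-- `x` is a nonsingular point of `Z(P)`. -/
def IsNonsingularPoint (P : MvPolynomial (Fin 3) ℝ) (x : E3) : Prop :=
  x ∈ zeroSurface P ∧ polyGrad P x ≠ 0

/-- `Z(P)` is a smooth algebraic surface: all its points are nonsingular. -/
def IsSmoothSurface (P : MvPolynomial (Fin 3) ℝ) : Prop :=
  ∀ x ∈ zeroSurface P, IsNonsingularPoint P x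

/-- The (linear) tangent plane of `Z(P)` at a nonsingular point. -/
def tangentPlane (P : MvPolynomial (Fin 3) ℝ) (x : E3) : Submodule ℝ E3 :=
  (Submodule.span ℝ {polyGrad P x})ᗮ

/-- The position of a tube in space: its center and its unit direction. -/
structure Tube where
  center : E3
  dir : E3
  norm_dir : ‖dir‖ = 1

/-- The dilate `lam T` about its center of the tube `T` of length `R` and radius `R^(1/2+δ)`. -/
def Tube.dilate (T : Tube) (δ R lam : ℝ) : Set E3 :=
  {x | |inner ℝ (x - T.center) T.dir| ≤ lam * R / 2 ∧
    ‖(x - T.center) - (inner ℝ (x - T.center) T.dir : ℝ) • T.dir‖ ≤ lam * R ^ (1 / 2 + δ)}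

/-- The tube itself, as a set. -/
def Tube.carrier (T : Tube) (δ R : ℝ) : Set E3 := T.dilate δ R 1

/-- The fat surface `S`: the `R^(1/2+δ)`-neighborhood of `Z(P)` in the ball `B(a, R)`. -/
def fatSurface (P : MvPolynomial (Fin 3) ℝ) (δ R : ℝ) (a : E3) : Set E3 :=
  Metric.cthickening (R ^ (1 / 2 + δ)) (zeroSurface P) ∩ Metric.closedBall a R

/-- `T` is tangential to the fat surface `S` around `Z(P)` in `B(a, R)`. -/
def IsTangentialTube (P : MvPolynomial (Fin 3) ℝ) (δ R : ℝ) (a : E3) (T : Tube) : Prop :=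
  (T.dilate δ R 2 ∩ zeroSurface P).Nonempty ∧
    ∀ x, IsNonsingularPoint P x → x ∈ T.dilate δ R 10 → x ∈ Metric.closedBall a (2 * R) →
      subspaceAngle T.dir (tangentPlane P x) ≤ R ^ (-1 / 2 + 2 * δ)

/-- `T` is tangential to the fat surface in the essential sense: it is tangential, and inside `S`
it meets a tangential tube whose direction makes an angle at least `K⁻¹` with that of `T`. -/
def IsEssTangentialTube (P : MvPolynomial (Fin 3) ℝ) (δ R K : ℝ) (a : E3) (T : Tube) : Prop :=
  IsTangentialTube P δ R a T ∧
    ∃ T' : Tube, IsTangentialTube P δ R a T' ∧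
      (T.carrier δ R ∩ T'.carrier δ R ∩ fatSurface P δ R a).Nonempty ∧
      K⁻¹ ≤ lineAngle T.dir T'.dir

/-- `H` is a plane in `ℝ³`. -/
def IsPlane (H : AffineSubspace ℝ E3) : Prop :=
  (H : Set E3).Nonempty ∧ Module.finrank ℝ H.direction = 2

/-- `T` is `R^(-1/2+δ)`-tangential to the plane `H`: its direction makes an angle at most
`R^(-1/2+δ)` with `H`, and it stays in the `2 R^(1/2+δ)`-neighborhood of `H`
(the tube has radius `R^(1/2+δ)`). -/
def IsTangentialToPlane (δ R : ℝ) (T : Tube) (H : AffineSubspace ℝ E3) : Prop :=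
  subspaceAngle T.dir H.direction ≤ R ^ (-1 / 2 + δ) ∧
    T.carrier δ R ⊆ Metric.cthickening (2 * R ^ (1 / 2 + δ)) (H : Set E3)

end

/-! Write `L = R ^ δ`, `r = R ^ (1/2 + δ)` for the radius of the tubes and `α = R ^ (-1/2 + 2δ)` for
the tangency angle. If `R ^ (1/2)` is less than a constant times `L ^ 5`, the tubes in the direction
`e` that meet the ball are covered by about `R / r` parallel planes. Otherwise the ball is cut into
about `L ^ 15` cubical cells of side `s` about `R / L ^ 5`, and it is enough to find boundedly many
planes for the tubes whose crossing with a transversal tube lies in a given cell.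

Such a crossing yields a point `z` of the surface `Z` near which `Z` is tangential both to `e` and to
a second direction `v`. In coordinates with `e` as the second axis and `v 0 = 1`, the plane through
`z` spanned by `e` and `v` carries the tube. The heart of the matter (`exists_close_to_plane`) is
that among boundedly many such points of one cell some `z j` is `2 r`-close to the plane of an
earlier `z i`; a maximal family without such pairs then gives the planes
(`exists_finset_covering`, `exists_planes_of_cell`).

To see this, note that a point of `Z` near the line `z i + ℝ v i` can be moved inside `Z` along
`v i`, with a small error, because the tangency gives enough room to correct the motion within the
planes `x 0 = c` (`exists_zero_of_slide`). So all the points `z i` can be brought to a common plane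
`x 0 = c`. If two of them arrive in the same connected piece of the slice of `Z`, both are moved
along their own directions to the plane `x 0 = z j 0`, and they stay in a common piece. There the
piece of `z j` is trapped between the planes `|x 2 - z j 2| = σ` for some `σ ≤ r`: otherwise moving
points of `Z` along `e` and then along `v j` would produce more than `d` zeros of `P` on the line
`x 0 = z j 0`, `x 1 = z j 1` (`CrossTangent.exists_gap`). Hence `z i + (z j 0 - z i 0) v i` is close
to `z j` in the last coordinate.

Connected pieces are handled in a form that needs neither connected components nor the
stratification of real algebraic sets. The surface is replaced by the sublevel set `Q ≤ t` of
`Q = P ^ 2 + η (x₁ ^ (2d+2) + x₂ ^ (2d+2))` (`confine`), whose slices are compact, and pieces by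
quasi-components (`Unseparated`). The restrictions of polynomials to the critical set of `x ↦ Q x` in
the planes `x 0 = c` span small spaces, since there the powers `x₁ ^ (2d+1)` and `x₂ ^ (2d+1)` reduce
to lower degree (`polyRestrict_mem_span`). By dimension counts a slice has at most `(2d+1)²` critical
points, hence at most as many quasi-components (`card_le_of_separated`), and for generic `t` all but
boundedly many slices are regular (`exists_criticalValues`). Over an interval of regular slices the
relation of lying in the same quasi-component is open and closed along continuous motions
(`eventually_unseparated`, `eventually_not_unseparated`), so it persists. -/

open Filter Topology

noncomputable section

/-! ### Polynomial functions and motions inside their zero sets -/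

/-- The polynomial function of `P` on `ℝ³`. -/
def polyEval (P : MvPolynomial (Fin 3) ℝ) (x : E3) : ℝ :=
  MvPolynomial.eval (fun i => x i) P

theorem hasFDerivAt_polyEval (P : MvPolynomial (Fin 3) ℝ) (x : E3) :
    HasFDerivAt (polyEval P) (innerSL ℝ (polyGrad P x)) x := by
  induction P using MvPolynomial.induction_on with
  | C a =>
    have h : polyGrad (MvPolynomial.C a) x = 0 := by
      ext i; simp [polyGrad]
    rw [h, map_zero]
    have : polyEval (MvPolynomial.C a) = fun _ => a := by funext y; simp [polyEval]
    rw [this]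
    exact hasFDerivAt_const _ _
  | add p q hp hq =>
    have h : polyGrad (p + q) x = polyGrad p x + polyGrad q x := by
      ext i; simp [polyGrad]
    have h2 : polyEval (p + q) = polyEval p + polyEval q := by
      funext y; simp [polyEval]
    rw [h, map_add, h2]
    exact hp.add hq
  | mul_X p n hp =>
    have h2 : polyEval (p * MvPolynomial.X n) = fun y => polyEval p y * y n := by
      funext y; simp [polyEval]
    have hn : HasFDerivAt (fun y : E3 => y n) (EuclideanSpace.proj n : E3 →L[ℝ] ℝ) x :=
      (EuclideanSpace.proj n : E3 →L[ℝ] ℝ).hasFDerivAt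
    rw [h2]
    have : polyGrad (p * MvPolynomial.X n) x
        = polyEval p x • EuclideanSpace.single n 1 + (x n) • polyGrad p x := by
      ext i
      by_cases hi : i = n
      · subst hi
        simp [polyGrad, polyEval]
      · simp [polyGrad, polyEval, hi]
    refine (hp.mul hn).congr_fderiv ?_
    ext v
    simp [this, EuclideanSpace.inner_single_left]

theorem continuous_polyEval (P : MvPolynomial (Fin 3) ℝ) : Continuous (polyEval P) :=
  continuous_iff_continuousAt.2 fun x => (hasFDerivAt_polyEval P x).continuousAt

theorem polyGrad_apply (P : MvPolynomial (Fin 3) ℝ) (x : E3) (i : Fin 3) :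
    polyGrad P x i = polyEval (MvPolynomial.pderiv i P) x := rfl

theorem continuous_polyGrad (P : MvPolynomial (Fin 3) ℝ) : Continuous (polyGrad P) := by
  have : Continuous fun x : E3 => fun i => polyEval (MvPolynomial.pderiv i P) x :=
    continuous_pi fun i => continuous_polyEval _
  exact (PiLp.continuous_toLp 2 _).comp this

theorem hasDerivAt_polyEval_line (P : MvPolynomial (Fin 3) ℝ) (x v : E3) (s : ℝ) :
    HasDerivAt (fun τ : ℝ => polyEval P (x + τ • v)) (inner ℝ (polyGrad P (x + s • v)) v) s := by
  have h1 : HasDerivAt (fun τ : ℝ => x + τ • v) v s := by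
    simpa using ((hasDerivAt_id s).smul_const v).const_add x
  have := (hasFDerivAt_polyEval P (x + s • v)).comp_hasDerivAt s h1
  exact this

/-- A function with positive derivative at a zero is positive just to the right of it. -/
theorem eventually_pos_of_deriv_pos {f : ℝ → ℝ} {f' : ℝ} (hf : HasDerivAt f f' 0) (h0 : f 0 = 0)
    (hf' : 0 < f') : ∀ᶠ τ in nhdsWithin (0 : ℝ) (Set.Ioi 0), 0 < f τ := by
  have h1 := (hasDerivAt_iff_tendsto_slope.1 hf).eventually (eventually_gt_nhds hf')
  have h2 : nhdsWithin (0 : ℝ) (Set.Ioi 0) ≤ nhdsWithin (0 : ℝ) {0}ᶜ :=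
    nhdsWithin_mono _ fun x hx => ne_of_gt hx
  filter_upwards [h2 h1, self_mem_nhdsWithin] with τ h3 h4
  have h4' : (0 : ℝ) < τ := h4
  simp only [slope, h0, vsub_eq_sub, sub_zero, smul_eq_mul] at h3
  exact (pos_iff_pos_of_mul_pos h3).1 (inv_pos.2 h4')

/-- Infinitesimal motion inside a zero set: if the derivative along `v` is dominated by `c` times
the derivative along `ω`, then the zero `x` can be continued to times `τ > 0` as
`x + τ (v + θ ω)` with `|θ| ≤ c`. -/
theorem eventually_exists_zero (P : MvPolynomial (Fin 3) ℝ) {x v ω : E3} {c : ℝ} (hc : 0 ≤ c)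
    (hx : polyEval P x = 0)
    (h : |inner ℝ (polyGrad P x) v| < c * inner ℝ (polyGrad P x) ω) :
    ∀ᶠ τ in nhdsWithin (0 : ℝ) (Set.Ioi 0),
      ∃ θ : ℝ, |θ| ≤ c ∧ polyEval P (x + τ • (v + θ • ω)) = 0 := by
  have hp := hasDerivAt_polyEval_line P x (v + c • ω) 0
  have hm := (hasDerivAt_polyEval_line P x (v + (-c) • ω) 0).neg
  simp only [zero_smul, add_zero, inner_add_right, inner_smul_right] at hp hm
  have h1 := eventually_pos_of_deriv_pos hp (by simp [hx]) (by linarith [(abs_lt.1 h).1])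
  have h2 := eventually_pos_of_deriv_pos hm (by simp [hx]) (by linarith [(abs_lt.1 h).2])
  filter_upwards [h1, h2] with τ h3 h4
  simp only [Pi.neg_apply] at h4
  have hcont : Continuous fun θ : ℝ => polyEval P (x + τ • (v + θ • ω)) :=
    (continuous_polyEval P).comp (by fun_prop)
  have := intermediate_value_Icc (by linarith : -c ≤ c) hcont.continuousOn
  obtain ⟨θ, hθ, h5⟩ := this (show (0 : ℝ) ∈ _ from ⟨by linarith, h3.le⟩)
  exact ⟨θ, abs_le.2 hθ, h5⟩

/-- Continuous induction for a closed relation with bounded fibres: if every point over `s < l` can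
be continued to a point over some larger parameter, then there is a point over `l`. -/
theorem exists_of_continuation {X : Type*} [TopologicalSpace X] {A : Set (ℝ × X)} {K : Set X}
    {l : ℝ} (hl : 0 ≤ l) (hA : IsClosed A) (hK : IsCompact K)
    (hAK : ∀ p ∈ A, 0 ≤ p.1 → p.1 ≤ l → p.2 ∈ K) (h0 : ∃ x, ((0 : ℝ), x) ∈ A)
    (hstep : ∀ p ∈ A, 0 ≤ p.1 → p.1 < l → ∃ s, p.1 < s ∧ s ≤ l ∧ ∃ x, (s, x) ∈ A) :
    ∃ x, (l, x) ∈ A := by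
  have hc : IsCompact (A ∩ (Set.Icc 0 l ×ˢ K)) :=
    (isCompact_Icc.prod hK).inter_left hA
  have hi := hc.image continuous_fst
  obtain ⟨x0, hx0⟩ := h0
  obtain ⟨m, ⟨⟨⟨s, x⟩, ⟨hsA, hs, -⟩, rfl⟩, hmax⟩⟩ := hi.exists_isGreatest
    ⟨0, (0, x0), ⟨hx0, ⟨le_refl _, hl⟩, hAK _ hx0 le_rfl hl⟩, rfl⟩
  rcases eq_or_lt_of_le hs.2 with h | h
  · simp only at h
    exact ⟨x, h ▸ hsA⟩
  · obtain ⟨s', h1, h2, x', h3⟩ := hstep _ hsA hs.1 h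
    have := hmax ⟨(s', x'), ⟨h3, ⟨hs.1.trans h1.le, h2⟩, hAK _ h3 (hs.1.trans h1.le) h2⟩, rfl⟩
    simp only at this h1
    linarith

/-- Long motion inside a zero set, with corrections in the subspace `W`. -/
theorem exists_zero_of_slide (P : MvPolynomial (Fin 3) ℝ) {x₀ v : E3} {c l : ℝ} (hc : 0 ≤ c)
    (hl : 0 ≤ l) (W : Submodule ℝ E3) (hx₀ : polyEval P x₀ = 0)
    (h : ∀ s x, 0 ≤ s → s < l → polyEval P x = 0 → x - x₀ - s • v ∈ W → ‖x - x₀ - s • v‖ ≤ c * s →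
      ∃ ω ∈ W, ‖ω‖ ≤ 1 ∧ |inner ℝ (polyGrad P x) v| < c * inner ℝ (polyGrad P x) ω) :
    ∃ x, polyEval P x = 0 ∧ x - x₀ - l • v ∈ W ∧ ‖x - x₀ - l • v‖ ≤ c * l := by
  let A : Set (ℝ × E3) := {p | polyEval P p.2 = 0 ∧ p.2 - x₀ - p.1 • v ∈ W ∧
    ‖p.2 - x₀ - p.1 • v‖ ≤ c * p.1}
  have hA : IsClosed A := by
    refine (isClosed_eq ((continuous_polyEval P).comp continuous_snd) continuous_const).inter
      (IsClosed.inter ?_ ?_)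
    · exact (Submodule.closed_of_finiteDimensional W).preimage
        (f := fun p : ℝ × E3 => p.2 - x₀ - p.1 • v) (by fun_prop)
    · exact isClosed_le (f := fun p : ℝ × E3 => ‖p.2 - x₀ - p.1 • v‖)
        (g := fun p : ℝ × E3 => c * p.1) (by fun_prop) (by fun_prop)
  refine exists_of_continuation (A := A) (K := Metric.closedBall x₀ (c * l + l * ‖v‖)) hl hA
    (isCompact_closedBall _ _) ?_ ⟨x₀, by simp [A, hx₀]⟩ ?_
  · rintro ⟨s, x⟩ ⟨-, -, h3⟩ hs hsl
    simp only at h3 hs hsl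
    rw [Metric.mem_closedBall, dist_eq_norm]
    calc ‖x - x₀‖ = ‖(x - x₀ - s • v) + s • v‖ := by congr 1; abel
      _ ≤ ‖x - x₀ - s • v‖ + ‖s • v‖ := norm_add_le _ _
      _ ≤ c * l + l * ‖v‖ := by
        rw [norm_smul, Real.norm_of_nonneg hs]; gcongr
        exact h3.trans (by gcongr)
  · rintro ⟨s, x⟩ ⟨h1, h2, h3⟩ hs hsl
    simp only at h1 h2 h3 hs hsl
    obtain ⟨ω, hω, hω1, hlt⟩ := h s x hs hsl h1 h2 h3
    have hev := eventually_exists_zero P hc h1 hlt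
    have hlt' : ∀ᶠ τ in nhdsWithin (0 : ℝ) (Set.Ioi 0), τ < l - s :=
      (eventually_lt_nhds (by linarith : (0 : ℝ) < l - s)).filter_mono nhdsWithin_le_nhds
    obtain ⟨τ, ⟨θ, hθ, hz⟩, hτl, hτ⟩ := (hev.and (hlt'.and self_mem_nhdsWithin)).exists
    have hτ' : (0 : ℝ) < τ := hτ
    have e : x + τ • (v + θ • ω) - x₀ - (s + τ) • v = (x - x₀ - s • v) + (τ * θ) • ω := by
      module
    refine ⟨s + τ, by simp only; linarith, by linarith, x + τ • (v + θ • ω), hz, ?_, ?_⟩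
    · simp only
      rw [e]
      exact W.add_mem h2 (W.smul_mem _ hω)
    · simp only
      rw [e]
      refine (norm_add_le _ _).trans ?_
      rw [norm_smul, Real.norm_eq_abs, abs_mul, abs_of_pos hτ']
      have : τ * |θ| * ‖ω‖ ≤ τ * c * 1 := by gcongr
      linarith

/-- A polynomial of degree at most `d` that does not vanish identically on a line has at most `d`
zeros on it. -/
theorem card_zeros_on_line_le (P : MvPolynomial (Fin 3) ℝ) {d : ℕ} (hd : P.totalDegree ≤ d)
    (x v : E3) (S : Finset ℝ) (hS : ∀ s ∈ S, polyEval P (x + s • v) = 0)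
    (hne : ∃ s : ℝ, polyEval P (x + s • v) ≠ 0) : S.card ≤ d := by
  let p : Polynomial ℝ :=
    MvPolynomial.aeval (fun i => Polynomial.C (x i) + Polynomial.C (v i) * Polynomial.X) P
  have hev : ∀ s, p.eval s = polyEval P (x + s • v) := by
    intro s
    simp only [p, polyEval]
    rw [← Polynomial.coe_evalRingHom, MvPolynomial.aeval_def, MvPolynomial.hom_eval₂,
      MvPolynomial.eval, MvPolynomial.coe_eval₂Hom]
    congr 1
    · ext; simp
    · funext i; simp; ring
  have hp : p ≠ 0 := by
    rintro h
    obtain ⟨s, hs⟩ := hne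
    rw [← hev, h] at hs
    simp at hs
  have hdeg : p.natDegree ≤ d := by
    have := MvPolynomial.aeval_natDegree_le (m := d) (n := 1) P hd
      (fun i => Polynomial.C (x i) + Polynomial.C (v i) * Polynomial.X)
      (fun i => by
        refine (Polynomial.natDegree_add_le _ _).trans ?_
        simp only [Polynomial.natDegree_C, zero_le, sup_of_le_right]
        exact (Polynomial.natDegree_C_mul_le _ _).trans Polynomial.natDegree_X_le)
    simpa using this
  have hsub : S ⊆ p.roots.toFinset := by
    intro s hs
    rw [Multiset.mem_toFinset, Polynomial.mem_roots hp, Polynomial.IsRoot, hev]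
    exact hS s hs
  calc S.card ≤ p.roots.toFinset.card := Finset.card_le_card hsub
    _ ≤ p.roots.card := Multiset.toFinset_card_le _
    _ ≤ p.natDegree := Polynomial.card_roots' p
    _ ≤ d := hdeg

/-! ### Quasi-components of slices -/

/-- `x` and `y` lie in the same quasi-component of `F`: no partition of `F` into two relatively open
pieces separates them. -/
def Unseparated (F : Set E3) (x y : E3) : Prop :=
  ∀ U V : Set E3, IsOpen U → IsOpen V → F ⊆ U ∪ V → (∀ z ∈ F, z ∈ U → z ∉ V) → x ∈ U → y ∈ U

theorem Unseparated.trans {F : Set E3} {x y z : E3} (h : Unseparated F x y)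
    (h' : Unseparated F y z) : Unseparated F x z :=
  fun U V hU hV hF hd hx => h' U V hU hV hF hd (h U V hU hV hF hd hx)

theorem Unseparated.symm {F : Set E3} {x y : E3} (h : Unseparated F x y) (hx : x ∈ F) (hy : y ∈ F) :
    Unseparated F y x := by
  intro U V hU hV hF hd hyU
  by_contra hxU
  have hxV : x ∈ V := (hF hx).resolve_left hxU
  exact hd y hy hyU (h V U hV hU (by rwa [Set.union_comm]) (fun z hz h1 h2 => hd z hz h2 h1) hxV)

theorem Unseparated.of_segment {F : Set E3} {x y : E3} (h : segment ℝ x y ⊆ F) :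
    Unseparated F x y := by
  intro U V hU hV hF hd hx
  by_contra hyU
  have hy := right_mem_segment ℝ x y
  have hyV : y ∈ V := (hF (h hy)).resolve_left hyU
  obtain ⟨z, hz, hzU, hzV⟩ := (convex_segment x y).isPreconnected U V hU hV (h.trans hF)
    ⟨x, left_mem_segment ℝ x y, hx⟩ ⟨y, hy, hyV⟩
  exact hd z (h hz) hzU hzV

/-- The slice by the plane `x 0 = c` of the sublevel set `{Q ≤ t}`. -/
def slice (Q : MvPolynomial (Fin 3) ℝ) (t c : ℝ) : Set E3 :=
  {x | x 0 = c ∧ polyEval Q x ≤ t}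

/-- At the boundary points of the slice `{x 0 = c, Q ≤ t}` the polynomial `Q` has nonzero derivative
in some direction of the plane `x 0 = c`. -/
def RegularSlice (Q : MvPolynomial (Fin 3) ℝ) (t c : ℝ) : Prop :=
  ∀ x, x 0 = c → polyEval Q x = t → ∃ ω : E3, ω 0 = 0 ∧ inner ℝ (polyGrad Q x) ω < 0

theorem continuous_coord (i : Fin 3) : Continuous fun x : E3 => x i :=
  (EuclideanSpace.proj i : E3 →L[ℝ] ℝ).continuous

theorem isClosed_slice (Q : MvPolynomial (Fin 3) ℝ) (t c : ℝ) : IsClosed (slice Q t c) :=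
  (isClosed_eq (continuous_coord 0) continuous_const).inter
    (isClosed_le (continuous_polyEval Q) continuous_const)

theorem segment_coord {x y z : E3} (hz : z ∈ segment ℝ x y) (h : x 0 = y 0) : z 0 = x 0 := by
  obtain ⟨a, b, -, -, hab, rfl⟩ := hz
  simp only [PiLp.add_apply, PiLp.smul_apply, smul_eq_mul, ← h]
  rw [← add_mul, hab, one_mul]

/-- Two points in the same slice of a small ball lie in the same quasi-component of that slice. -/
theorem exists_ball_unseparated (Q : MvPolynomial (Fin 3) ℝ) {t : ℝ} {x : E3}
    (hx : polyEval Q x ≤ t) (hreg : RegularSlice Q t (x 0)) :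
    ∃ ε > 0, ∀ y ∈ Metric.ball x ε, ∀ z ∈ Metric.ball x ε, y 0 = z 0 → polyEval Q y ≤ t →
      polyEval Q z ≤ t → Unseparated (slice Q t (y 0)) y z := by
  have hball : ∀ x' : E3, polyEval Q x' < t → ∃ ε > 0, ∀ y ∈ Metric.ball x' ε,
      ∀ z ∈ Metric.ball x' ε, y 0 = z 0 → Unseparated (slice Q t (y 0)) y z := by
    intro x' hx'
    obtain ⟨ε, hε, hb⟩ := Metric.isOpen_iff.1
      (isOpen_lt (continuous_polyEval Q) continuous_const) x' hx'
    refine ⟨ε, hε, fun y hy z hz hyz => Unseparated.of_segment fun w hw => ?_⟩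
    exact ⟨segment_coord hw hyz, (hb ((convex_ball x' ε).segment_subset hy hz hw)).le⟩
  rcases lt_or_eq_of_le hx with hlt | heq
  · obtain ⟨ε, hε, h⟩ := hball x hlt
    exact ⟨ε, hε, fun y hy z hz hyz _ _ => h y hy z hz hyz⟩
  obtain ⟨ω, hω0, hω⟩ := hreg x rfl heq
  have hopen : IsOpen {z | inner ℝ (polyGrad Q z) ω < 0} :=
    isOpen_lt ((continuous_polyGrad Q).inner continuous_const) continuous_const
  obtain ⟨ε₁, hε₁, hb⟩ := Metric.isOpen_iff.1 hopen x hω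
  have hωn : 0 ≤ ‖ω‖ := norm_nonneg _
  set s : ℝ := ε₁ / (2 * (‖ω‖ + 1)) with hs
  have hs0 : 0 < s := by positivity
  have hsω : s * ‖ω‖ < ε₁ / 2 := by
    rw [hs, div_mul_eq_mul_div, div_lt_div_iff₀ (by positivity) (by norm_num)]
    nlinarith
  -- from every point near `x` the function `Q` decreases along `ω` up to time `s`
  have hmono : ∀ y ∈ Metric.ball x (ε₁ / 2),
      StrictAntiOn (fun σ : ℝ => polyEval Q (y + σ • ω)) (Set.Icc 0 s) := by
    intro y hy
    refine strictAntiOn_of_deriv_neg (convex_Icc 0 s)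
      ((continuous_polyEval Q).comp (by fun_prop)).continuousOn ?_
    intro σ hσ
    rw [interior_Icc] at hσ
    rw [(hasDerivAt_polyEval_line Q y ω σ).deriv]
    refine hb ?_
    rw [Metric.mem_ball, dist_eq_norm] at hy ⊢
    have : y + σ • ω - x = (y - x) + σ • ω := by abel
    rw [this]
    refine (norm_add_le _ _).trans_lt ?_
    rw [norm_smul, Real.norm_of_nonneg hσ.1.le]
    have : σ * ‖ω‖ ≤ s * ‖ω‖ := by gcongr; exact hσ.2.le
    linarith
  have hlt : polyEval Q (x + s • ω) < t := by
    have := hmono x (Metric.mem_ball_self (by positivity)) ⟨le_rfl, hs0.le⟩ ⟨hs0.le, le_rfl⟩ hs0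
    simp only [zero_smul, add_zero] at this
    linarith
  obtain ⟨ε₂, hε₂, h2⟩ := hball _ hlt
  have hdown : ∀ y ∈ Metric.ball x (ε₁ / 2), polyEval Q y ≤ t →
      segment ℝ y (y + s • ω) ⊆ slice Q t (y 0) := by
    intro y hy hyt w hw
    rw [segment_eq_image'] at hw
    obtain ⟨θ, hθ, rfl⟩ := hw
    simp only [add_sub_cancel_left, smul_smul]
    have hm : θ * s ∈ Set.Icc 0 s := ⟨mul_nonneg hθ.1 hs0.le, by nlinarith [hθ.2]⟩
    refine ⟨by simp [hω0], le_trans ?_ hyt⟩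
    have := (hmono y hy).antitoneOn ⟨le_rfl, hs0.le⟩ hm hm.1
    simpa using this
  refine ⟨min (ε₁ / 2) ε₂, by positivity, fun y hy z hz hyz hyt hzt => ?_⟩
  have hy1 := Metric.ball_subset_ball (min_le_left _ _) hy
  have hz1 := Metric.ball_subset_ball (min_le_left _ _) hz
  have hsh : ∀ p ∈ Metric.ball x (min (ε₁ / 2) ε₂), p + s • ω ∈ Metric.ball (x + s • ω) ε₂ := by
    intro p hp
    rw [Metric.mem_ball, dist_add_right]
    exact Metric.ball_subset_ball (min_le_right _ _) hp
  have e0 : ∀ p : E3, (p + s • ω) 0 = p 0 := by intro p; simp [hω0]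
  have a1 : Unseparated (slice Q t (y 0)) y (y + s • ω) :=
    Unseparated.of_segment (hdown y hy1 hyt)
  have a2 : Unseparated (slice Q t (y 0)) (y + s • ω) (z + s • ω) := by
    have := h2 _ (hsh y hy) _ (hsh z hz) (by rw [e0, e0, hyz])
    rwa [e0] at this
  have a3 : Unseparated (slice Q t (y 0)) (z + s • ω) z := by
    refine Unseparated.of_segment ?_
    rw [segment_symm, hyz]
    exact hdown z hz1 hzt
  exact a1.trans (a2.trans a3)

/-- A regular slice is the closure of its points with `Q < t`. -/
theorem exists_lt_near (Q : MvPolynomial (Fin 3) ℝ) {t : ℝ} {x : E3} (hx : polyEval Q x ≤ t)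
    (hreg : RegularSlice Q t (x 0)) {W : Set E3} (hW : IsOpen W) (hxW : x ∈ W) :
    ∃ y ∈ W, y 0 = x 0 ∧ polyEval Q y < t := by
  rcases lt_or_eq_of_le hx with hlt | heq
  · exact ⟨x, hxW, rfl, hlt⟩
  obtain ⟨ω, hω0, hω⟩ := hreg x rfl heq
  have hd := ((hasDerivAt_polyEval_line Q x ω 0).const_sub t)
  simp only [zero_smul, add_zero] at hd
  have h1 := eventually_pos_of_deriv_pos hd (by simp [heq]) (by linarith)
  have hc : Continuous fun τ : ℝ => x + τ • ω := by fun_prop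
  have h2 : ∀ᶠ τ in 𝓝[>] (0 : ℝ), x + τ • ω ∈ W :=
    ((hc.tendsto 0).eventually (hW.mem_nhds (by simpa using hxW))).filter_mono nhdsWithin_le_nhds
  obtain ⟨τ, h3, h4⟩ := (h1.and h2).exists
  exact ⟨x + τ • ω, h4, by simp [hω0], by linarith⟩

/-- Lying in the same quasi-component of a regular slice persists under small motions. -/
theorem eventually_unseparated (Q : MvPolynomial (Fin 3) ℝ) {t c : ℝ}
    (hreg : RegularSlice Q t c) (hcpt : IsCompact (slice Q t c)) {x₁ x₂ : E3}
    (hx₁ : x₁ ∈ slice Q t c) (h : Unseparated (slice Q t c) x₁ x₂) :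
    ∀ᶠ p : ℝ × E3 × E3 in 𝓝 (c, x₁, x₂), p.2.1 ∈ slice Q t p.1 → p.2.2 ∈ slice Q t p.1 →
      Unseparated (slice Q t p.1) p.2.1 p.2.2 := by
  have hL : ∀ x : E3, ∃ W : Set E3, IsOpen W ∧ x ∈ W ∧ (x ∈ slice Q t c → ∀ y ∈ W, ∀ z ∈ W,
      y 0 = z 0 → polyEval Q y ≤ t → polyEval Q z ≤ t → Unseparated (slice Q t (y 0)) y z) := by
    intro x
    by_cases hx : x ∈ slice Q t c
    · obtain ⟨ε, hε, h1⟩ := exists_ball_unseparated Q hx.2 (by rw [hx.1]; exact hreg)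
      exact ⟨_, Metric.isOpen_ball, Metric.mem_ball_self hε, fun _ => h1⟩
    · exact ⟨Set.univ, isOpen_univ, trivial, fun h => absurd h hx⟩
  choose W hWo hxW hWu using hL
  obtain ⟨T, hT, hcov⟩ := hcpt.elim_nhds_subcover W fun x _ => (hWo x).mem_nhds (hxW x)
  let rel : E3 → E3 → Prop := fun k l => k ∈ T ∧ l ∈ T ∧ ∃ y ∈ slice Q t c, y ∈ W k ∧ y ∈ W l
  obtain ⟨k₁, hk₁, hx₁k⟩ : ∃ k ∈ T, x₁ ∈ W k := by simpa using hcov hx₁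
  -- the part of the slice covered by the `W k` in the chain class of `k₁` is relatively clopen
  have hreach : ∃ k ∈ T, Relation.ReflTransGen rel k₁ k ∧ x₂ ∈ W k := by
    have := h (⋃ k ∈ {k | k ∈ T ∧ Relation.ReflTransGen rel k₁ k}, W k)
      (⋃ k ∈ {k | k ∈ T ∧ ¬ Relation.ReflTransGen rel k₁ k}, W k)
      (isOpen_biUnion fun k _ => hWo k) (isOpen_biUnion fun k _ => hWo k) ?_ ?_ ?_
    · simpa [and_assoc] using this
    · intro z hz
      obtain ⟨k, hk, hzk⟩ : ∃ k ∈ T, z ∈ W k := by simpa using hcov hz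
      by_cases hr : Relation.ReflTransGen rel k₁ k
      · exact Or.inl (Set.mem_biUnion (show k ∈ {k | k ∈ T ∧ _} from ⟨hk, hr⟩) hzk)
      · exact Or.inr (Set.mem_biUnion (show k ∈ {k | k ∈ T ∧ _} from ⟨hk, hr⟩) hzk)
    · intro z hz hzU hzV
      simp only [Set.mem_iUnion, Set.mem_ofPred_eq, exists_prop] at hzU hzV
      obtain ⟨k, ⟨hk, hr⟩, hzk⟩ := hzU
      obtain ⟨l, ⟨hl, hnr⟩, hzl⟩ := hzV
      exact hnr (hr.tail ⟨hk, hl, z, hz, hzk, hzl⟩)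
    · exact Set.mem_biUnion (show k₁ ∈ {k | k ∈ T ∧ _} from ⟨hk₁, Relation.ReflTransGen.refl⟩) hx₁k
  obtain ⟨k₂, hk₂, hr, hx₂k⟩ := hreach
  have hnear : ∀ᶠ c' in 𝓝 c, ∀ k ∈ T, ∀ l ∈ T, rel k l →
      ∃ y ∈ slice Q t c', y ∈ W k ∧ y ∈ W l := by
    rw [eventually_all_finset]
    intro k _
    rw [eventually_all_finset]
    intro l _
    by_cases hkl : rel k l
    · obtain ⟨-, -, y, hy, hyk, hyl⟩ := hkl
      obtain ⟨z, ⟨hzk, hzl⟩, hz0, hzt⟩ := exists_lt_near Q hy.2 (by rw [hy.1]; exact hreg)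
        ((hWo k).inter (hWo l)) ⟨hyk, hyl⟩
      have hz0c : z 0 = c := hz0.trans hy.1
      let g : ℝ → E3 := fun c' => z + (c' - c) • EuclideanSpace.single 0 1
      have hg : Continuous g := by fun_prop
      have hgc : g c = z := by simp [g]
      have hopen : IsOpen {p | p ∈ W k ∧ p ∈ W l ∧ polyEval Q p < t} :=
        (hWo k).inter ((hWo l).inter (isOpen_lt (continuous_polyEval Q) continuous_const))
      have := (hg.tendsto c).eventually (hopen.mem_nhds (by rw [hgc]; exact ⟨hzk, hzl, hzt⟩))
      filter_upwards [this] with c' hc' _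
      exact ⟨g c', ⟨by simp [g, hz0c], hc'.2.2.le⟩, hc'.1, hc'.2.1⟩
    · exact Eventually.of_forall fun c' h => absurd h hkl
  have hn : ∀ᶠ p : ℝ × E3 × E3 in 𝓝 (c, x₁, x₂), (∀ k ∈ T, ∀ l ∈ T, rel k l →
      ∃ y ∈ slice Q t p.1, y ∈ W k ∧ y ∈ W l) ∧ p.2.1 ∈ W k₁ ∧ p.2.2 ∈ W k₂ := by
    refine ((continuous_fst.tendsto (c, x₁, x₂)).eventually hnear).and (Eventually.and ?_ ?_)
    · exact (continuous_fst.comp continuous_snd).continuousAt.eventually ((hWo k₁).mem_nhds hx₁k)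
    · exact (continuous_snd.comp continuous_snd).continuousAt.eventually ((hWo k₂).mem_nhds hx₂k)
  filter_upwards [hn] with p hp h1 h2
  obtain ⟨hpr, hp1, hp2⟩ := hp
  have key : ∀ k, Relation.ReflTransGen rel k₁ k → ∀ y ∈ slice Q t p.1, y ∈ W k →
      Unseparated (slice Q t p.1) p.2.1 y := by
    intro k hk
    induction hk with
    | refl =>
      intro y hy hyk
      have := hWu k₁ (hT k₁ hk₁) _ hp1 _ hyk (h1.1.trans hy.1.symm) h1.2 hy.2
      rwa [h1.1] at this
    | @tail k l _ hkl ih =>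
      intro y hy hyl
      obtain ⟨z, hz, hzk, hzl⟩ := hpr k hkl.1 l hkl.2.1 hkl
      have := hWu l (hT l hkl.2.1) _ hzl _ hyl (hz.1.trans hy.1.symm) hz.2 hy.2
      rw [hz.1] at this
      exact (ih z hz hzk).trans this
  exact key k₂ hr _ h2 hp2

/-- Lying in different quasi-components of a slice persists under small motions. -/
theorem eventually_not_unseparated (Q : MvPolynomial (Fin 3) ℝ) {t c : ℝ}
    (hcpt : ∀ M, IsCompact {x : E3 | |x 0| ≤ M ∧ polyEval Q x ≤ t}) {x₁ x₂ : E3}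
    (hx₁ : x₁ ∈ slice Q t c) (hx₂ : x₂ ∈ slice Q t c) (h : ¬ Unseparated (slice Q t c) x₁ x₂) :
    ∀ᶠ p : ℝ × E3 × E3 in 𝓝 (c, x₁, x₂), ¬ Unseparated (slice Q t p.1) p.2.1 p.2.2 := by
  unfold Unseparated at h
  push Not at h
  obtain ⟨U, V, hU, hV, hcov, hd, hx₁U, hx₂U⟩ := h
  have hsc : IsCompact (slice Q t c) :=
    (hcpt |c|).of_isClosed_subset (isClosed_slice Q t c) fun x hx => ⟨by rw [hx.1], hx.2⟩
  obtain ⟨U', V', hU', hV', hAU, hBV, hdis⟩ := SeparatedNhds.of_isCompact_isCompact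
    (hsc.diff hV) (hsc.diff hU)
    (Set.disjoint_left.2 fun z hz hz' => (hcov hz.1).elim hz'.2 hz.2)
  have hcov' : slice Q t c ⊆ U' ∪ V' := by
    intro z hz
    by_cases hzV : z ∈ V
    · exact Or.inr (hBV ⟨hz, fun hzU => hd z hz hzU hzV⟩)
    · exact Or.inl (hAU ⟨hz, hzV⟩)
  have hx₁' : x₁ ∈ U' := hAU ⟨hx₁, fun hV => hd x₁ hx₁ hx₁U hV⟩
  have hx₂' : x₂ ∈ V' := hBV ⟨hx₂, hx₂U⟩
  have hG : IsCompact ({x : E3 | |x 0| ≤ |c| + 1 ∧ polyEval Q x ≤ t} \ (U' ∪ V')) :=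
    (hcpt _).diff (hU'.union hV')
  have hGi := (hG.image (continuous_coord 0)).isClosed
  have hcn : c ∉ (fun x : E3 => x 0) ''
      ({x : E3 | |x 0| ≤ |c| + 1 ∧ polyEval Q x ≤ t} \ (U' ∪ V')) := by
    rintro ⟨z, ⟨⟨-, hz⟩, hz'⟩, hzc⟩
    exact hz' (hcov' ⟨hzc, hz⟩)
  have hev : ∀ᶠ c' in 𝓝 c, slice Q t c' ⊆ U' ∪ V' := by
    have h1 : ∀ᶠ c' in 𝓝 c, |c'| < |c| + 1 :=
      (continuous_abs.tendsto c).eventually (eventually_lt_nhds (by linarith))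
    filter_upwards [h1, hGi.isOpen_compl.mem_nhds hcn] with c' h2 h3 z hz
    by_contra hzn
    exact h3 ⟨z, ⟨⟨by rw [hz.1]; exact h2.le, hz.2⟩, hzn⟩, hz.1⟩
  have h1 : ∀ᶠ p : ℝ × E3 × E3 in 𝓝 (c, x₁, x₂), slice Q t p.1 ⊆ U' ∪ V' :=
    (continuous_fst.tendsto (c, x₁, x₂)).eventually hev
  have h2 : ∀ᶠ p : ℝ × E3 × E3 in 𝓝 (c, x₁, x₂), p.2.1 ∈ U' :=
    (continuous_fst.comp continuous_snd).continuousAt.eventually (hU'.mem_nhds hx₁')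
  have h3 : ∀ᶠ p : ℝ × E3 × E3 in 𝓝 (c, x₁, x₂), p.2.2 ∈ V' :=
    (continuous_snd.comp continuous_snd).continuousAt.eventually (hV'.mem_nhds hx₂')
  filter_upwards [h1, h2, h3] with p hp1 hp2 hp3 hun
  have := hun U' V' hU' hV' hp1 (fun z _ hzU hzV => Set.disjoint_left.1 hdis hzU hzV) hp2
  exact Set.disjoint_left.1 hdis this hp3

/-! ### Critical points of slices -/

theorem totalDegree_pderiv_le (p : MvPolynomial (Fin 3) ℝ) (i : Fin 3) :
    (MvPolynomial.pderiv i p).totalDegree ≤ p.totalDegree := by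
  refine Finset.sup_le fun s hs => ?_
  rw [MvPolynomial.mem_support_iff, MvPolynomial.coeff_pderiv] at hs
  have h1 : s + Finsupp.single i 1 ∈ p.support :=
    MvPolynomial.mem_support_iff.2 fun h => hs (by rw [h, zero_mul])
  refine le_trans ?_ (MvPolynomial.le_totalDegree h1)
  rw [Finsupp.sum_add_index' (fun _ => rfl) (fun _ _ _ => rfl)]
  exact Nat.le_add_right _ _

/-- The restriction of the polynomial `p` to `S`, as a function. -/
def polyRestrict (S : Set E3) (p : MvPolynomial (Fin 3) ℝ) : S → ℝ := fun x => polyEval p x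

/-- The monomials `x₀ ^ k x₁ ^ i x₂ ^ j` with `k ≤ D` and `i, j ≤ N`, restricted to `S`. -/
def reducedMonomial (S : Set E3) (D N : ℕ) (m : Fin (D + 1) × Fin (N + 1) × Fin (N + 1)) : S → ℝ :=
  fun x => (x : E3) 0 ^ (m.1 : ℕ) * (x : E3) 1 ^ (m.2.1 : ℕ) * (x : E3) 2 ^ (m.2.2 : ℕ)

/-- If on `S` the powers `x₁ ^ (N + 1)` and `x₂ ^ (N + 1)` agree with polynomials of degree at most
`N`, then every polynomial of degree at most `D` agrees on `S` with a combination of the monomials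
`x₀ ^ k x₁ ^ i x₂ ^ j` with `k ≤ D` and `i, j ≤ N`. -/
theorem polyRestrict_mem_span {S : Set E3} {N : ℕ} {G : Fin 3 → MvPolynomial (Fin 3) ℝ}
    (hG : ∀ i, (G i).totalDegree ≤ N)
    (hS : ∀ x ∈ S, ∀ i, i ≠ 0 → x i ^ (N + 1) = polyEval (G i) x) (D : ℕ) :
    ∀ p : MvPolynomial (Fin 3) ℝ, p.totalDegree ≤ D →
      polyRestrict S p ∈ Submodule.span ℝ (Set.range (reducedMonomial S D N)) := by
  induction D using Nat.strong_induction_on with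
  | _ D ih =>
    have hmono : ∀ D' < D, ∀ f, f ∈ Submodule.span ℝ (Set.range (reducedMonomial S D' N)) →
        f ∈ Submodule.span ℝ (Set.range (reducedMonomial S D N)) := by
      intro D' hD' f hf
      refine Submodule.span_mono ?_ hf
      rintro _ ⟨⟨k, i, j⟩, rfl⟩
      exact ⟨⟨⟨k, by omega⟩, i, j⟩, rfl⟩
    have hmon : ∀ s : Fin 3 →₀ ℕ, s.sum (fun _ e => e) ≤ D →
        polyRestrict S (MvPolynomial.monomial s 1) ∈
          Submodule.span ℝ (Set.range (reducedMonomial S D N)) := by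
      intro s hs
      have hsum : s.sum (fun _ e => e) = s 0 + s 1 + s 2 := by
        rw [Finsupp.sum_fintype _ _ (fun _ => rfl), Fin.sum_univ_three]
      rw [hsum] at hs
      by_cases hbig : ∃ i, i ≠ 0 ∧ N + 1 ≤ s i
      · obtain ⟨i, hi, hsi⟩ := hbig
        -- a high power of `x i` is replaced by `G i`, which lowers the total degree
        obtain ⟨s', rfl⟩ : ∃ s', s = s' + Finsupp.single i (N + 1) :=
          ⟨s - Finsupp.single i (N + 1), by
            ext j
            by_cases hj : j = i
            · subst hj; simp; omega
            · simp [Ne.symm hj]⟩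
        have hs' : s'.sum (fun _ e => e) + (N + 1) ≤ D := by
          rw [Finsupp.sum_fintype _ _ (fun _ => rfl), Fin.sum_univ_three]
          have : (Finsupp.single i (N + 1) : Fin 3 →₀ ℕ) 0 + (Finsupp.single i (N + 1) : Fin 3 →₀ ℕ) 1
              + (Finsupp.single i (N + 1) : Fin 3 →₀ ℕ) 2 = N + 1 := by
            fin_cases i <;> simp at hi ⊢
          simp only [Finsupp.add_apply] at hs
          omega
        have heq : polyRestrict S (MvPolynomial.monomial (s' + Finsupp.single i (N + 1)) 1) =
            polyRestrict S (MvPolynomial.monomial s' 1 * G i) := by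
          funext x
          have h1 : (MvPolynomial.monomial (s' + Finsupp.single i (N + 1)) (1 : ℝ)) =
              MvPolynomial.monomial s' 1 * MvPolynomial.X i ^ (N + 1) := by
            rw [MvPolynomial.X_pow_eq_monomial, MvPolynomial.monomial_mul, mul_one]
          have h2 := hS x x.2 i hi
          simp only [polyEval] at h2
          simp only [polyRestrict, polyEval, h1, map_mul, map_pow, MvPolynomial.eval_X, h2]
        rw [heq]
        have hlt : s'.sum (fun _ e => e) + N < D := by omega
        refine hmono _ hlt _ (ih _ hlt _ ?_)
        exact (MvPolynomial.totalDegree_mul _ _).trans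
          (add_le_add (MvPolynomial.totalDegree_monomial_le _ _) (hG i))
      · push Not at hbig
        have h1 := hbig 1 (by decide)
        have h2 := hbig 2 (by decide)
        refine Submodule.subset_span ⟨⟨⟨s 0, by omega⟩, ⟨s 1, h1⟩, ⟨s 2, h2⟩⟩, ?_⟩
        funext x
        simp only [reducedMonomial, polyRestrict, polyEval, MvPolynomial.eval_monomial, one_mul]
        rw [Finsupp.prod_fintype _ _ (fun _ => pow_zero _), Fin.prod_univ_three]
    intro p hp
    have : polyRestrict S p = ∑ s ∈ p.support, p.coeff s •
        polyRestrict S (MvPolynomial.monomial s 1) := by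
      funext x
      simp only [polyRestrict, polyEval, Finset.sum_apply, Pi.smul_apply, smul_eq_mul]
      conv_lhs => rw [p.as_sum, map_sum]
      refine Finset.sum_congr rfl fun s _ => ?_
      simp [MvPolynomial.eval_monomial]
    rw [this]
    refine Submodule.sum_mem _ fun s hs => Submodule.smul_mem _ _ (hmon s ?_)
    exact (MvPolynomial.le_totalDegree hs).trans hp

/-- Polynomials separate the points of a finite set. -/
theorem exists_separating_polynomial (S : Finset E3) (a : E3) :
    ∃ p : MvPolynomial (Fin 3) ℝ, polyEval p a ≠ 0 ∧ ∀ b ∈ S, b ≠ a → polyEval p b = 0 := by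
  classical
  refine ⟨∏ b ∈ S.erase a, ∑ i, (MvPolynomial.X i - MvPolynomial.C (b i)) ^ 2, ?_, ?_⟩
  · simp only [polyEval, map_prod, map_sum, map_pow, map_sub, MvPolynomial.eval_X,
      MvPolynomial.eval_C]
    rw [Finset.prod_ne_zero_iff]
    intro b hb h0
    rw [Finset.sum_eq_zero_iff_of_nonneg (fun _ _ => sq_nonneg _)] at h0
    refine Finset.ne_of_mem_erase hb ?_
    ext i
    have := pow_eq_zero_iff (two_ne_zero) |>.1 (h0 i (Finset.mem_univ i))
    linarith
  · intro b hb hba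
    simp only [polyEval, map_prod, map_sum, map_pow, map_sub, MvPolynomial.eval_X,
      MvPolynomial.eval_C]
    exact Finset.prod_eq_zero (Finset.mem_erase.2 ⟨hba, hb⟩) (by simp)

/-- The polynomial `P² + η (x₁ ^ (2d+2) + x₂ ^ (2d+2))`: for small `η` and `t` its sublevel set
`{≤ t}` is a thin neighbourhood of a compact piece of `Z(P)` in each plane `x 0 = c`. -/
def confine (P : MvPolynomial (Fin 3) ℝ) (d : ℕ) (η : ℝ) : MvPolynomial (Fin 3) ℝ :=
  P ^ 2 + MvPolynomial.C η * (MvPolynomial.X 1 ^ (2 * d + 2) + MvPolynomial.X 2 ^ (2 * d + 2))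

theorem polyEval_confine (P : MvPolynomial (Fin 3) ℝ) (d : ℕ) (η : ℝ) (x : E3) :
    polyEval (confine P d η) x
      = polyEval P x ^ 2 + η * (x 1 ^ (2 * d + 2) + x 2 ^ (2 * d + 2)) := by
  simp [polyEval, confine]

/-- The critical points of the restrictions of `Q` to the planes `x 0 = c`. -/
def sliceCritical (Q : MvPolynomial (Fin 3) ℝ) : Set E3 :=
  {x | polyGrad Q x 1 = 0 ∧ polyGrad Q x 2 = 0}

theorem totalDegree_confine_le {P : MvPolynomial (Fin 3) ℝ} {d : ℕ} (hd : P.totalDegree ≤ d)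
    (η : ℝ) : (confine P d η).totalDegree ≤ 2 * d + 2 := by
  refine (MvPolynomial.totalDegree_add _ _).trans (max_le ?_ ?_)
  · refine (MvPolynomial.totalDegree_pow _ _).trans ?_
    omega
  · refine (MvPolynomial.totalDegree_mul _ _).trans ?_
    rw [MvPolynomial.totalDegree_C, zero_add]
    refine (MvPolynomial.totalDegree_add _ _).trans (max_le ?_ ?_) <;>
      rw [MvPolynomial.totalDegree_X_pow]

/-- On the critical points of `confine P d η` in the planes `x 0 = c`, the high powers of the
coordinates `x₁`, `x₂` agree with polynomials of lower degree. -/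
theorem exists_reduction {P : MvPolynomial (Fin 3) ℝ} {d : ℕ} (hd : P.totalDegree ≤ d) {η : ℝ}
    (hη : 0 < η) : ∃ G : Fin 3 → MvPolynomial (Fin 3) ℝ, (∀ i, (G i).totalDegree ≤ 2 * d) ∧
      ∀ x ∈ sliceCritical (confine P d η), ∀ i, i ≠ 0 → x i ^ (2 * d + 1) = polyEval (G i) x := by
  refine ⟨fun i => MvPolynomial.C (-(η * (2 * d + 2))⁻¹) * MvPolynomial.pderiv i (P ^ 2), ?_, ?_⟩
  · intro i
    refine (MvPolynomial.totalDegree_mul _ _).trans ?_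
    rw [MvPolynomial.totalDegree_C, zero_add]
    refine (totalDegree_pderiv_le _ _).trans ((MvPolynomial.totalDegree_pow _ _).trans ?_)
    omega
  · intro x hx i hi
    have key : polyGrad (confine P d η) x i =
        polyEval (MvPolynomial.pderiv i (P ^ 2)) x + η * ((2 * d + 2) * x i ^ (2 * d + 1)) := by
      rw [polyGrad_apply]
      fin_cases i
      · exact absurd rfl hi
      · have h12 : (2 : Fin 3) ≠ 1 := by decide
        simp [confine, polyEval, MvPolynomial.pderiv_X_of_ne h12]
      · have h12 : (1 : Fin 3) ≠ 2 := by decide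
        simp [confine, polyEval, MvPolynomial.pderiv_X_of_ne h12]
    have h0 : polyGrad (confine P d η) x i = 0 := by
      fin_cases i
      · exact absurd rfl hi
      · exact hx.1
      · exact hx.2
    rw [key] at h0
    have hne : η * (2 * (d : ℝ) + 2) ≠ 0 := by positivity
    simp only [polyEval, map_mul, MvPolynomial.eval_C] at h0 ⊢
    field_simp
    linarith

/-- A plane `x 0 = c` contains at most `(2d+1)²` critical points of `confine P d η` restricted to
it. -/
theorem card_sliceCritical_le {P : MvPolynomial (Fin 3) ℝ} {d : ℕ} (hd : P.totalDegree ≤ d) {η : ℝ}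
    (hη : 0 < η) (c : ℝ) (S : Finset E3) (hS : ∀ x ∈ S, x ∈ sliceCritical (confine P d η) ∧ x 0 = c) :
    S.card ≤ (2 * d + 1) ^ 2 := by
  classical
  obtain ⟨G, hG, hred⟩ := exists_reduction hd hη
  let b : Fin (2 * d + 1) × Fin (2 * d + 1) → ↥(S : Set E3) → ℝ :=
    fun m x => (x : E3) 1 ^ (m.1 : ℕ) * (x : E3) 2 ^ (m.2 : ℕ)
  have hpoly : ∀ p, polyRestrict (S : Set E3) p ∈ Submodule.span ℝ (Set.range b) := by
    intro p
    have h1 := polyRestrict_mem_span (S := (S : Set E3)) hG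
      (fun x hx i hi => hred x (hS x hx).1 i hi) _ p le_rfl
    refine Submodule.span_le.2 ?_ h1
    rintro _ ⟨⟨k, i, j⟩, rfl⟩
    have : reducedMonomial (S : Set E3) p.totalDegree (2 * d) (k, i, j) = c ^ (k : ℕ) • b (i, j) := by
      funext x
      simp only [reducedMonomial, b, Pi.smul_apply, smul_eq_mul, (hS x x.2).2, mul_assoc]
    rw [this]
    exact Submodule.smul_mem _ _ (Submodule.subset_span ⟨_, rfl⟩)
  have htop : Submodule.span ℝ (Set.range b) = ⊤ := by
    rw [eq_top_iff]
    intro f _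
    choose p hp1 hp2 using fun a => exists_separating_polynomial S a
    have : f = ∑ a : ↥(S : Set E3), (f a / polyEval (p a) a) • polyRestrict (S : Set E3) (p a) := by
      funext x
      rw [Finset.sum_apply, Finset.sum_eq_single x]
      · simp [polyRestrict, hp1]
      · intro a _ hax
        have := hp2 a x x.2 (fun h => hax (Subtype.ext h.symm))
        simp [polyRestrict, this]
      · simp
    rw [this]
    exact Submodule.sum_mem _ fun a _ => Submodule.smul_mem _ _ (hpoly _)
  have h1 := finrank_range_le_card (R := ℝ) b
  rw [Set.finrank, htop, finrank_top, Module.finrank_fintype_fun_eq_card] at h1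
  simp only [Fintype.card_prod, Fintype.card_fin] at h1
  have h2 : Fintype.card (S : Set E3) = S.card := by simp
  rw [h2] at h1
  rw [sq]
  exact h1

/-- A bound for the number of critical values of `x 0` on a level set of `confine P d η`. -/
def criticalValueBound (d : ℕ) : ℕ := (2 * d + 2) * (2 * (2 * d + 1) ^ 2 - 1)

/-- For all but finitely many levels `t`, the function `x 0` has boundedly many critical values on
`{confine P d η = t}`: the functions `x₀ ^ a Q ^ b` on the critical set satisfy a nontrivial linear
relation, by a dimension count. -/
theorem exists_criticalValues {P : MvPolynomial (Fin 3) ℝ} {d : ℕ} (hd : P.totalDegree ≤ d) {η : ℝ}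
    (hη : 0 < η) : ∃ bad : Finset ℝ, ∀ t, t ∉ bad → ∃ V : Finset ℝ,
      V.card ≤ criticalValueBound d ∧
      ∀ x ∈ sliceCritical (confine P d η), polyEval (confine P d η) x = t → x 0 ∈ V := by
  classical
  set Q := confine P d η with hQ
  obtain ⟨G, hG, hred⟩ := exists_reduction hd hη
  obtain ⟨B, hB⟩ : ∃ B, B + 1 = 2 * (2 * d + 1) ^ 2 :=
    ⟨2 * (2 * d + 1) ^ 2 - 1, by have : 0 < (2 * d + 1) ^ 2 := by positivity
                                 omega⟩
  set A := (2 * d + 2) * B with hA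
  have hAd : criticalValueBound d = A := by rw [criticalValueBound, hA, ← hB]; rfl
  set D := A + (2 * d + 2) * B with hD
  let W := Submodule.span ℝ (Set.range (reducedMonomial (sliceCritical Q) D (2 * d)))
  have hmem : ∀ m : Fin (A + 1) × Fin (B + 1), polyRestrict (sliceCritical Q)
      (MvPolynomial.X 0 ^ (m.1 : ℕ) * Q ^ (m.2 : ℕ)) ∈ W := by
    intro m
    refine polyRestrict_mem_span hG (fun x hx i hi => hred x hx i hi) D _ ?_
    refine (MvPolynomial.totalDegree_mul _ _).trans (add_le_add ?_ ?_)
    · rw [MvPolynomial.totalDegree_X_pow]; omega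
    · refine (MvPolynomial.totalDegree_pow _ _).trans ?_
      rw [mul_comm]
      exact Nat.mul_le_mul (totalDegree_confine_le hd η) (by omega)
  have hWfin : Module.Finite ℝ W := FiniteDimensional.span_of_finite ℝ (Set.finite_range _)
  let v : Fin (A + 1) × Fin (B + 1) → W := fun m => ⟨_, hmem m⟩
  have hdep : ¬ LinearIndependent ℝ v := by
    intro hli
    have h1 := hli.fintype_card_le_finrank
    have h2 : Module.finrank ℝ W ≤ _ :=
      finrank_range_le_card (R := ℝ) (reducedMonomial (sliceCritical Q) D (2 * d))
    simp only [Fintype.card_prod, Fintype.card_fin] at h1 h2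
    have h3 := h1.trans h2
    rw [hB, hD, ← hA] at h3
    have : 0 < (2 * d + 1) ^ 2 := by positivity
    nlinarith
  rw [Fintype.not_linearIndependent_iff] at hdep
  obtain ⟨f, hf, ⟨a₀, b₀⟩, hab⟩ := hdep
  have hrel : ∀ x ∈ sliceCritical Q, ∑ a : Fin (A + 1), (∑ b : Fin (B + 1),
      f (a, b) * polyEval Q x ^ (b : ℕ)) * x 0 ^ (a : ℕ) = 0 := by
    intro x hx
    have h1 := congrArg (fun w : W => (w : sliceCritical Q → ℝ) ⟨x, hx⟩) hf
    simp only [Submodule.coe_sum, Submodule.coe_smul, Finset.sum_apply, Pi.smul_apply, v,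
      polyRestrict, smul_eq_mul, ZeroMemClass.coe_zero, Pi.zero_apply] at h1
    rw [Fintype.sum_prod_type] at h1
    rw [← h1]
    refine Finset.sum_congr rfl fun a _ => ?_
    rw [Finset.sum_mul]
    refine Finset.sum_congr rfl fun b _ => ?_
    simp only [polyEval, map_mul, map_pow, MvPolynomial.eval_X]
    ring
  let p : Fin (A + 1) → Polynomial ℝ := fun a =>
    ∑ b : Fin (B + 1), Polynomial.C (f (a, b)) * Polynomial.X ^ (b : ℕ)
  have hpe : ∀ a t, (p a).eval t = ∑ b : Fin (B + 1), f (a, b) * t ^ (b : ℕ) := by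
    intro a t
    simp [p, Polynomial.eval_finsetSum]
  have hp0 : p a₀ ≠ 0 := by
    intro h
    have := congrArg (fun q => Polynomial.coeff q b₀) h
    simp only [p, Polynomial.finsetSum_coeff, Polynomial.coeff_C_mul, Polynomial.coeff_X_pow,
      Polynomial.coeff_zero] at this
    rw [Finset.sum_eq_single b₀] at this
    · simp at this
      exact hab this
    · intro b _ hb
      have : (b₀ : ℕ) ≠ b := fun h => hb (Fin.ext h.symm)
      simp [this]
    · simp
  refine ⟨(p a₀).roots.toFinset, fun t ht => ?_⟩
  let g : Polynomial ℝ := ∑ a : Fin (A + 1), Polynomial.C ((p a).eval t) * Polynomial.X ^ (a : ℕ)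
  have hg0 : g ≠ 0 := by
    intro h
    have := congrArg (fun q => Polynomial.coeff q a₀) h
    simp only [g, Polynomial.finsetSum_coeff, Polynomial.coeff_C_mul, Polynomial.coeff_X_pow,
      Polynomial.coeff_zero] at this
    rw [Finset.sum_eq_single a₀] at this
    · simp only [if_true, mul_one] at this
      exact ht (Multiset.mem_toFinset.2 ((Polynomial.mem_roots hp0).2 this))
    · intro a _ ha
      have : (a₀ : ℕ) ≠ a := fun h => ha (Fin.ext h.symm)
      simp [this]
    · simp
  have hgd : g.natDegree ≤ A := by
    refine Polynomial.natDegree_sum_le_of_forall_le _ _ fun a _ => ?_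
    refine (Polynomial.natDegree_C_mul_X_pow_le _ _).trans ?_
    omega
  refine ⟨g.roots.toFinset, ?_, fun x hx hxt => ?_⟩
  · rw [hAd]
    exact (Multiset.toFinset_card_le _).trans ((Polynomial.card_roots' g).trans hgd)
  · rw [Multiset.mem_toFinset, Polynomial.mem_roots hg0, Polynomial.IsRoot]
    have := hrel x hx
    simp only [g, Polynomial.eval_finsetSum, Polynomial.eval_mul, Polynomial.eval_C,
      Polynomial.eval_pow, Polynomial.eval_X, hpe]
    rw [hxt] at this
    exact this

/-- A fixed slice is regular for all but finitely many levels. -/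
theorem finite_critical_levels {P : MvPolynomial (Fin 3) ℝ} {d : ℕ} (hd : P.totalDegree ≤ d)
    {η : ℝ} (hη : 0 < η) (c : ℝ) :
    {t | ∃ x ∈ sliceCritical (confine P d η), x 0 = c ∧ polyEval (confine P d η) x = t}.Finite := by
  have h1 : (sliceCritical (confine P d η) ∩ {x | x 0 = c}).Finite := by
    by_contra h
    obtain ⟨S, hS, hcard⟩ := Set.Infinite.exists_subset_card_eq h ((2 * d + 1) ^ 2 + 1)
    have := card_sliceCritical_le hd hη c S fun x hx => hS hx
    omega
  refine (h1.image (polyEval (confine P d η))).subset ?_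
  rintro t ⟨x, hx, hxc, rfl⟩
  exact ⟨x, ⟨hx, hxc⟩, rfl⟩

theorem exists_descent_direction {Q : MvPolynomial (Fin 3) ℝ} {x : E3} (h : x ∉ sliceCritical Q) :
    ∃ ω : E3, ω 0 = 0 ∧ inner ℝ (polyGrad Q x) ω < 0 := by
  have : ∃ i : Fin 3, i ≠ 0 ∧ polyGrad Q x i ≠ 0 := by
    by_contra hn
    push Not at hn
    exact h ⟨hn 1 (by decide), hn 2 (by decide)⟩
  obtain ⟨i, hi, hne⟩ := this
  refine ⟨EuclideanSpace.single i (-polyGrad Q x i), ?_, ?_⟩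
  · simp [hi.symm]
  · rw [EuclideanSpace.inner_single_right]
    simpa using hne

theorem regularSlice_of_forall {Q : MvPolynomial (Fin 3) ℝ} {t c : ℝ}
    (h : ∀ x ∈ sliceCritical Q, polyEval Q x = t → x 0 ≠ c) : RegularSlice Q t c :=
  fun x hx hxt => exists_descent_direction fun hcr => h x hcr hxt hx

/-- A slice of a sublevel set of `confine P d η` has at most `(2d+1)²` quasi-components, since each
of them contains a minimum of the polynomial. -/
theorem card_le_of_separated {P : MvPolynomial (Fin 3) ℝ} {d : ℕ} (hd : P.totalDegree ≤ d) {η : ℝ}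
    (hη : 0 < η) {t c : ℝ} (hcpt : IsCompact (slice (confine P d η) t c)) {k : ℕ} (x : Fin k → E3)
    (hx : ∀ i, x i ∈ slice (confine P d η) t c)
    (hsep : ∀ i j, i ≠ j → ¬ Unseparated (slice (confine P d η) t c) (x i) (x j)) :
    k ≤ (2 * d + 1) ^ 2 := by
  classical
  set Q := confine P d η with hQ
  set F := slice Q t c with hF
  have hC : ∀ i j, i ≠ j → ∃ C : Set F, IsClopen C ∧ ⟨x i, hx i⟩ ∈ C ∧ ⟨x j, hx j⟩ ∉ C := by
    intro i j hij
    have := hsep i j hij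
    unfold Unseparated at this
    push Not at this
    obtain ⟨U, V, hU, hV, hcov, hd', hi, hj⟩ := this
    refine ⟨Subtype.val ⁻¹' U, ⟨?_, hU.preimage continuous_subtype_val⟩, hi, hj⟩
    have : (Subtype.val ⁻¹' U : Set F) = (Subtype.val ⁻¹' V)ᶜ := by
      ext z
      simp only [Set.mem_preimage, Set.mem_compl_iff]
      exact ⟨fun h => hd' z z.2 h, fun h => (hcov z.2).resolve_right h⟩
    rw [this]
    exact (hV.preimage continuous_subtype_val).isClosed_compl
  choose C hCc hCi hCj using hC
  let A : Fin k → Set F := fun i => ⋂ j, ⋂ h : i ≠ j, C i j h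
  have hA : ∀ i, IsClopen (A i) := fun i =>
    isClopen_iInter_of_finite fun j => isClopen_iInter_of_finite fun h => hCc i j h
  let B : Fin k → Set F := fun i => A i ∩ ⋂ j : Fin k, ⋂ _ : j < i, (A j)ᶜ
  have hB : ∀ i, IsClopen (B i) := fun i =>
    (hA i).inter (isClopen_iInter_of_finite fun j => isClopen_iInter_of_finite fun _ => (hA j).compl)
  have hxB : ∀ i, (⟨x i, hx i⟩ : F) ∈ B i := by
    intro i
    refine ⟨Set.mem_iInter₂.2 fun j h => hCi i j h, Set.mem_iInter₂.2 fun j h hj => ?_⟩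
    exact hCj j i h.ne (Set.mem_iInter₂.1 hj i h.ne)
  have hdisj : ∀ i j, i < j → ∀ z, z ∈ B i → z ∉ B j := by
    intro i j hij z hz hz'
    exact (Set.mem_iInter₂.1 hz'.2 i hij) hz.1
  have hFc : CompactSpace F := isCompact_iff_compactSpace.1 hcpt
  have hmin : ∀ i, ∃ z ∈ B i, ∀ w ∈ B i, polyEval Q z ≤ polyEval Q w := by
    intro i
    exact (hB i).1.isCompact.exists_isMinOn ⟨_, hxB i⟩
      ((continuous_polyEval Q).comp continuous_subtype_val).continuousOn
  choose z hzB hzmin using hmin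
  have hcrit : ∀ i, (z i : E3) ∈ sliceCritical Q := by
    intro i
    by_contra hn
    obtain ⟨ω, hω0, hω⟩ := exists_descent_direction hn
    obtain ⟨O, hO, hOB⟩ := isOpen_induced_iff.1 (hB i).2
    have hd := ((hasDerivAt_polyEval_line Q (z i) ω 0).const_sub (polyEval Q (z i)))
    simp only [zero_smul, add_zero] at hd
    have h1 := eventually_pos_of_deriv_pos hd (by simp) (by linarith)
    have hc : Continuous fun τ : ℝ => (z i : E3) + τ • ω := by fun_prop
    have hzO : (z i : E3) ∈ O := by
      have := hzB i
      rw [← hOB] at this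
      exact this
    have h2 : ∀ᶠ τ in 𝓝[>] (0 : ℝ), (z i : E3) + τ • ω ∈ O :=
      ((hc.tendsto 0).eventually (hO.mem_nhds (by simpa using hzO))).filter_mono nhdsWithin_le_nhds
    obtain ⟨τ, h3, h4⟩ := (h1.and h2).exists
    have h5 : (z i : E3) + τ • ω ∈ F := ⟨by simp [hω0, (z i).2.1], by linarith [(z i).2.2]⟩
    have h6 : (⟨_, h5⟩ : F) ∈ B i := by rw [← hOB]; exact h4
    have := hzmin i _ h6
    simp only at this
    linarith
  have hinj : Function.Injective fun i => (z i : E3) := by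
    intro i j hij
    have hij' : z i = z j := Subtype.ext hij
    rcases lt_trichotomy i j with h | h | h
    · exact absurd (hij' ▸ hzB j) (hdisj i j h _ (hzB i))
    · exact h
    · exact absurd (hij' ▸ hzB i) (hdisj j i h _ (hzB j))
  have := card_sliceCritical_le hd hη c (Finset.univ.image fun i => (z i : E3)) (by
    intro w hw
    obtain ⟨i, -, rfl⟩ := Finset.mem_image.1 hw
    exact ⟨hcrit i, (z i).2.1⟩)
  rwa [Finset.card_image_of_injective _ hinj, Finset.card_univ, Fintype.card_fin] at this

theorem abs_coord_le_of_confine_le {P : MvPolynomial (Fin 3) ℝ} {d : ℕ} {η ρ t : ℝ} (hη : 0 < η)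
    (hρ : 0 ≤ ρ) (ht : t ≤ 3 * η * ρ ^ (2 * d + 2)) {x : E3}
    (hx : polyEval (confine P d η) x ≤ t) (i : Fin 3) (hi : i ≠ 0) : |x i| ≤ 2 * ρ := by
  rw [polyEval_confine] at hx
  have he : Even (2 * d + 2) := ⟨d + 1, by ring⟩
  have h1 := he.pow_nonneg (x 1)
  have h2 := he.pow_nonneg (x 2)
  have h3 := sq_nonneg (polyEval P x)
  have h4 : η * x i ^ (2 * d + 2) ≤ η * (3 * ρ ^ (2 * d + 2)) := by
    fin_cases i
    · exact absurd rfl hi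
    · simp only [Fin.mk_one]; nlinarith
    · simp only [Fin.reduceFinMk]; nlinarith
  have h5 := le_of_mul_le_mul_left h4 hη
  by_contra hlt
  push Not at hlt
  have h6 : (2 * ρ) ^ (2 * d + 2) < |x i| ^ (2 * d + 2) :=
    pow_lt_pow_left₀ hlt (by positivity) (by omega)
  rw [he.pow_abs, mul_pow] at h6
  have h7 : (4 : ℝ) ≤ 2 ^ (2 * d + 2) := by
    rw [pow_add]
    have : (1 : ℝ) ≤ 2 ^ (2 * d) := one_le_pow₀ (by norm_num)
    linarith
  have h8 : 0 ≤ ρ ^ (2 * d + 2) := by positivity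
  nlinarith

theorem isCompact_confine_le {P : MvPolynomial (Fin 3) ℝ} {d : ℕ} {η ρ t : ℝ} (hη : 0 < η)
    (hρ : 0 ≤ ρ) (ht : t ≤ 3 * η * ρ ^ (2 * d + 2)) (M : ℝ) :
    IsCompact {x : E3 | |x 0| ≤ M ∧ polyEval (confine P d η) x ≤ t} := by
  refine Metric.isCompact_of_isClosed_isBounded ?_ ?_
  · exact (isClosed_le (continuous_coord 0).abs continuous_const).inter
      (isClosed_le (continuous_polyEval _) continuous_const)
  · refine (Metric.isBounded_closedBall (x := (0 : E3)) (r := √(M ^ 2 + (2 * ρ) ^ 2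
      + (2 * ρ) ^ 2))).subset ?_
    rintro x ⟨h0, hx⟩
    have h1 := abs_coord_le_of_confine_le hη hρ ht hx 1 (by decide)
    have h2 := abs_coord_le_of_confine_le hη hρ ht hx 2 (by decide)
    rw [mem_closedBall_zero_iff, EuclideanSpace.norm_eq, Fin.sum_univ_three]
    refine Real.sqrt_le_sqrt ?_
    simp only [Real.norm_eq_abs]
    gcongr

/-! ### Surfaces tangential to two directions -/

theorem inner_eq_coord (a b : E3) : inner ℝ a b = a 0 * b 0 + a 1 * b 1 + a 2 * b 2 := by
  rw [PiLp.inner_apply, Fin.sum_univ_three]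
  simp [mul_comm]

theorem norm_sq_eq_coord (a : E3) : ‖a‖ ^ 2 = a 0 ^ 2 + a 1 ^ 2 + a 2 ^ 2 := by
  rw [← real_inner_self_eq_norm_sq, inner_eq_coord]
  ring

theorem abs_coord_le_norm (a : E3) (i : Fin 3) : |a i| ≤ ‖a‖ := by
  simpa using PiLp.norm_apply_le a i

theorem norm_le_sum_abs_coord (a : E3) : ‖a‖ ≤ |a 0| + |a 1| + |a 2| := by
  refine abs_le_of_sq_le_sq' ?_ (by positivity) |>.2
  rw [norm_sq_eq_coord, ← sq_abs (a 0), ← sq_abs (a 1), ← sq_abs (a 2)]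
  nlinarith [abs_nonneg (a 0), abs_nonneg (a 1), abs_nonneg (a 2),
    mul_nonneg (abs_nonneg (a 0)) (abs_nonneg (a 1)),
    mul_nonneg (abs_nonneg (a 0)) (abs_nonneg (a 2)),
    mul_nonneg (abs_nonneg (a 1)) (abs_nonneg (a 2))]

/-- The inequalities between the parameters of a cell: `r` is the radius of the tubes, `α` the
tangency angle, `s` the side of the cell, and `L` a bound for the reciprocal of the angle between
the two tubes through a point. -/
structure CellParameters (d : ℕ) (L α r s : ℝ) : Prop where
  one_le : 1 ≤ L
  pos_angle : 0 < α
  pos_radius : 0 < r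
  pos_side : 0 < s
  angle_le : 100 * L * α ≤ 1
  radius_le : r ≤ L * s
  drift_le : 2000 * (d + 1) * L ^ 4 * α * s ≤ r

/-- `z` is a point of `Z(P)` near which the surface is tangential to a tube in the direction of the
second coordinate axis and to a tube in the direction `v`. -/
structure CrossTangent (P : MvPolynomial (Fin 3) ℝ) (L α r s : ℝ) (z v : E3) : Prop where
  zero : polyEval P z = 0
  coord_le : ∀ k, |z k| ≤ s / 2
  dir_zero : v 0 = 1
  norm_dir_le : ‖v‖ ≤ 3 * L
  vertical : ∀ x, polyEval P x = 0 → |x 0 - z 0| ≤ 4 * r → |x 2 - z 2| ≤ 4 * r →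
    |x 1 - z 1| ≤ 20 * L * s → |polyGrad P x 1| ≤ α * ‖polyGrad P x‖
  along : ∀ x t, polyEval P x = 0 → |t| ≤ s → ‖x - z - t • v‖ ≤ 4 * r →
    |inner ℝ (polyGrad P x) v| ≤ 3 * L * α * ‖polyGrad P x‖

/-- The linear functional `x ↦ x i` has kernel the vectors with vanishing `i`-th coordinate. -/
def coordKer (i : Fin 3) : Submodule ℝ E3 :=
  LinearMap.ker (EuclideanSpace.proj i : E3 →L[ℝ] ℝ).toLinearMap

theorem mem_coordKer {i : Fin 3} {x : E3} : x ∈ coordKer i ↔ x i = 0 := Iff.rfl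

section Correction

variable {P : MvPolynomial (Fin 3) ℝ} {d : ℕ} {L α r s : ℝ} {z v : E3}

theorem CellParameters.drift_le' (h : CellParameters d L α r s) :
    2000 * (d + 1) * (L ^ 2 * α * s) ≤ r ∧ 2000 * (L ^ 3 * α * s) ≤ r := by
  have hL := h.one_le
  have hα := h.pos_angle
  have hs := h.pos_side
  have h0 : 0 < α * s := by positivity
  have h2 : L ^ 2 ≤ L ^ 4 := pow_le_pow_right₀ hL (by norm_num)
  have h3 : L ^ 3 ≤ L ^ 4 := pow_le_pow_right₀ hL (by norm_num)
  have h4 := h.drift_le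
  have hd : (0 : ℝ) ≤ d := d.cast_nonneg
  constructor
  · refine le_trans ?_ h4
    have : 2000 * ((d : ℝ) + 1) * (L ^ 2 * α * s) = 2000 * ((d : ℝ) + 1) * (α * s) * L ^ 2 := by ring
    rw [this]
    have : 2000 * ((d : ℝ) + 1) * L ^ 4 * α * s = 2000 * ((d : ℝ) + 1) * (α * s) * L ^ 4 := by ring
    rw [this]
    gcongr
  · refine le_trans ?_ h4
    calc 2000 * (L ^ 3 * α * s) = 2000 * (0 + 1) * (α * s) * L ^ 3 := by ring
      _ ≤ 2000 * ((d : ℝ) + 1) * (α * s) * L ^ 4 := by gcongr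
      _ = _ := by ring

/-- Where the surface is tangential to `v`, the correction of a motion along `v` within the planes
`x 0 = c` has speed at most `100 L³ α`. -/
theorem exists_correction_along (hL : 1 ≤ L) (hα : 0 < α) (hLα : 100 * L * α ≤ 1) {g : E3}
    (hg : g ≠ 0) (hv0 : v 0 = 1) (hv : ‖v‖ ≤ 3 * L) (h : |inner ℝ g v| ≤ 3 * L * α * ‖g‖) :
    ∃ ω ∈ coordKer 0, ‖ω‖ ≤ 1 ∧ |inner ℝ g v| < 100 * L ^ 3 * α * inner ℝ g ω := by
  have hG : 0 < ‖g‖ := norm_pos_iff.2 hg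
  have hsq := norm_sq_eq_coord g
  have hvsq := norm_sq_eq_coord v
  set w : E3 := !₂[0, g 1, g 2] with hw
  have hw2 := norm_sq_eq_coord w
  have w0 : w 0 = 0 := rfl
  have w1 : w 1 = g 1 := rfl
  have w2 : w 2 = g 2 := rfl
  rw [w0, w1, w2] at hw2
  have hgw : inner ℝ g w = ‖w‖ ^ 2 := by rw [inner_eq_coord, w0, w1, w2, hw2]; ring
  have hin : inner ℝ g v = g 0 + inner ℝ w v := by
    rw [inner_eq_coord, inner_eq_coord, w0, w1, w2, hv0]; ring
  have hcs : |inner ℝ w v| ≤ ‖w‖ * (3 * L) :=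
    (abs_real_inner_le_norm w v).trans (by gcongr)
  have hwn := norm_nonneg w
  have hg0 : |g 0| ≤ 3 * L * α * ‖g‖ + ‖w‖ * (3 * L) := by
    have : g 0 = inner ℝ g v - inner ℝ w v := by rw [hin]; ring
    rw [this]
    exact (abs_sub _ _).trans (add_le_add h hcs)
  have hGle : ‖g‖ ≤ |g 0| + ‖w‖ := by
    have e : g = EuclideanSpace.single 0 (g 0) + w := by
      ext i; fin_cases i <;> simp [hw]
    calc ‖g‖ = ‖EuclideanSpace.single 0 (g 0) + w‖ := by rw [← e]
      _ ≤ _ := (norm_add_le _ _).trans (by simp)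
  have hm : ‖g‖ ≤ 5 * L * ‖w‖ := by nlinarith
  refine ⟨‖g‖⁻¹ • w, ?_, ?_, ?_⟩
  · rw [mem_coordKer]; simp [w0]
  · rw [norm_smul, norm_inv, norm_norm, inv_mul_le_iff₀ hG, mul_one]
    refine abs_le_of_sq_le_sq' ?_ hG.le |>.2
    nlinarith [sq_nonneg (g 0)]
  · rw [inner_smul_right, hgw]
    refine h.trans_lt ?_
    have h1 : ‖g‖ ^ 2 ≤ 25 * L ^ 2 * ‖w‖ ^ 2 := by
      calc ‖g‖ ^ 2 ≤ (5 * L * ‖w‖) ^ 2 := by gcongr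
        _ = _ := by ring
    have h2 : ‖g‖ ≤ 25 * L ^ 2 * (‖g‖⁻¹ * ‖w‖ ^ 2) := by
      rw [← mul_le_mul_iff_right₀ hG]
      calc ‖g‖ * ‖g‖ = ‖g‖ ^ 2 := by ring
        _ ≤ _ := h1
        _ = ‖g‖ * (25 * L ^ 2 * (‖g‖⁻¹ * ‖w‖ ^ 2)) := by field_simp
    have h3 : 0 < L * α := by positivity
    calc 3 * L * α * ‖g‖ < 4 * (L * α) * ‖g‖ := by nlinarith [mul_pos h3 hG]
      _ ≤ 4 * (L * α) * (25 * L ^ 2 * (‖g‖⁻¹ * ‖w‖ ^ 2)) := by gcongr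
      _ = _ := by ring

/-- The correction of a vertical motion, within horizontal planes, has speed at most `3 α`. -/
theorem exists_correction_vertical (hα : 0 < α) (hα1 : 100 * α ≤ 1) {g : E3}
    (hg : g ≠ 0) (h : |g 1| ≤ α * ‖g‖) :
    ∃ ω ∈ coordKer 1, ‖ω‖ ≤ 1 ∧ |g 1| < 3 * α * inner ℝ g ω := by
  have hG : 0 < ‖g‖ := norm_pos_iff.2 hg
  have hsq := norm_sq_eq_coord g
  set w : E3 := !₂[g 0, 0, g 2] with hw
  have hw2 := norm_sq_eq_coord w
  have w0 : w 0 = g 0 := rfl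
  have w1 : w 1 = 0 := rfl
  have w2 : w 2 = g 2 := rfl
  rw [w0, w1, w2] at hw2
  have hgw : inner ℝ g w = ‖w‖ ^ 2 := by rw [inner_eq_coord, w0, w1, w2, hw2]; ring
  refine ⟨‖g‖⁻¹ • w, ?_, ?_, ?_⟩
  · rw [mem_coordKer]; simp [w1]
  · rw [norm_smul, norm_inv, norm_norm, inv_mul_le_iff₀ hG, mul_one]
    refine abs_le_of_sq_le_sq' ?_ hG.le |>.2
    nlinarith [sq_nonneg (g 1)]
  · rw [inner_smul_right, hgw]
    refine h.trans_lt ?_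
    have h1 : g 1 ^ 2 ≤ ‖g‖ ^ 2 / 2 := by
      have : |g 1| ≤ ‖g‖ / 2 := by nlinarith
      calc g 1 ^ 2 = |g 1| ^ 2 := (sq_abs _).symm
        _ ≤ (‖g‖ / 2) ^ 2 := by gcongr
        _ ≤ _ := by nlinarith [sq_nonneg ‖g‖]
    have h2 : ‖g‖ ≤ 2 * (‖g‖⁻¹ * ‖w‖ ^ 2) := by
      rw [← mul_le_mul_iff_right₀ hG]
      have : ‖g‖ * (2 * (‖g‖⁻¹ * ‖w‖ ^ 2)) = 2 * ‖w‖ ^ 2 := by field_simp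
      rw [this]
      nlinarith
    nlinarith [mul_pos hα hG]

/-- Where the surface is tangential to both directions, its normal has a large third component. -/
theorem norm_le_of_cross (hL : 1 ≤ L) (hα : 0 < α) (hLα : 100 * L * α ≤ 1) {g : E3}
    (hv0 : v 0 = 1) (hv : ‖v‖ ≤ 3 * L) (h : |inner ℝ g v| ≤ 3 * L * α * ‖g‖)
    (h1 : |g 1| ≤ α * ‖g‖) :
    |g 0 + g 2 * v 2| ≤ 6 * L * α * ‖g‖ ∧ ‖g‖ ≤ 8 * L * |g 2| := by
  have hv1 : |v 1| ≤ 3 * L := (abs_coord_le_norm v 1).trans hv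
  have hv2 : |v 2| ≤ 3 * L := (abs_coord_le_norm v 2).trans hv
  have hgn := norm_nonneg g
  have e1 : g 0 + g 2 * v 2 = inner ℝ g v - g 1 * v 1 := by
    rw [inner_eq_coord, hv0]; ring
  have e2 : |g 1 * v 1| ≤ α * ‖g‖ * (3 * L) := by
    rw [abs_mul]; gcongr
  have e3 : |g 0 + g 2 * v 2| ≤ 6 * L * α * ‖g‖ := by
    rw [e1]
    refine (abs_sub _ _).trans ?_
    linarith
  refine ⟨e3, ?_⟩
  have e4 : |g 2 * v 2| ≤ |g 2| * (3 * L) := by rw [abs_mul]; gcongr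
  have e5 : |g 0| ≤ 6 * L * α * ‖g‖ + |g 2| * (3 * L) := by
    have : g 0 = (g 0 + g 2 * v 2) - g 2 * v 2 := by ring
    rw [this]
    exact (abs_sub _ _).trans (add_le_add e3 e4)
  have e6 := norm_le_sum_abs_coord g
  have e7 := abs_nonneg (g 2)
  have e8 : 100 * (L * α * ‖g‖) ≤ ‖g‖ := by nlinarith
  have e9 : α * ‖g‖ ≤ L * α * ‖g‖ := by
    have : 0 ≤ α * ‖g‖ := by positivity
    nlinarith
  nlinarith

/-- The correction of a horizontal motion, along the third axis. -/
theorem exists_correction_horizontal (hL : 1 ≤ L) (hα : 0 < α) {g : E3}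
    (hg : g ≠ 0) {a : ℝ} (h : |a| ≤ 6 * L * α * ‖g‖) (h2 : ‖g‖ ≤ 8 * L * |g 2|) :
    ∃ ω ∈ coordKer 0 ⊓ coordKer 1, ‖ω‖ ≤ 1 ∧ |a| < 50 * L ^ 2 * α * inner ℝ g ω := by
  have hG : 0 < ‖g‖ := norm_pos_iff.2 hg
  have hlt : |a| < 50 * L ^ 2 * α * |g 2| := by
    refine h.trans_lt ?_
    have h3 : 0 < |g 2| := by
      by_contra hn
      have := abs_nonneg (g 2)
      have h0 : |g 2| = 0 := by linarith
      rw [h0, mul_zero] at h2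
      linarith
    have h4 : 0 < L ^ 2 * α := by positivity
    calc 6 * L * α * ‖g‖ ≤ 6 * L * α * (8 * L * |g 2|) := by gcongr
      _ = 48 * (L ^ 2 * α * |g 2|) := by ring
      _ < 50 * (L ^ 2 * α * |g 2|) := by nlinarith [mul_pos h4 h3]
      _ = _ := by ring
  have hmem : ∀ b : ℝ, (EuclideanSpace.single 2 b : E3) ∈ coordKer 0 ⊓ coordKer 1 := by
    intro b
    rw [Submodule.mem_inf, mem_coordKer, mem_coordKer]
    simp
  rcases le_total 0 (g 2) with hs | hs
  · refine ⟨EuclideanSpace.single 2 1, hmem 1, by simp, ?_⟩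
    rw [EuclideanSpace.inner_single_right]
    rw [abs_of_nonneg hs] at hlt
    simpa using hlt
  · refine ⟨EuclideanSpace.single 2 (-1), hmem _, by simp, ?_⟩
    rw [EuclideanSpace.inner_single_right]
    rw [abs_of_nonpos hs] at hlt
    simpa using hlt

/-- Moving a point of the surface vertically to the height of `z`, and then horizontally to the line
`{x 0 = z 0, x 1 = z 1}`, changes its third coordinate little. -/
theorem CrossTangent.exists_zero_on_line (h : CrossTangent P L α r s z v)
    (hp : CellParameters d L α r s) (hsm : ∀ x, polyEval P x = 0 → polyGrad P x ≠ 0) {x : E3}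
    (hx : polyEval P x = 0) (hx0 : x 0 = z 0) (hx1 : |x 1 - z 1| ≤ 17 * L * s)
    (hx2 : |x 2 - z 2| ≤ r) :
    ∃ y : E3, polyEval P y = 0 ∧ y 0 = z 0 ∧ y 1 = z 1 ∧ |y 2 - x 2| ≤ 255 * (L ^ 2 * α * s) := by
  have hL := hp.one_le
  have hα := hp.pos_angle
  have hr := hp.pos_radius
  have hs := hp.pos_side
  have hLα := hp.angle_le
  have hα1 : 100 * α ≤ 1 := by nlinarith
  have hdrift : 2000 * (L ^ 2 * α * s) ≤ r := by
    refine le_trans ?_ hp.drift_le'.1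
    have h0 : 0 ≤ L ^ 2 * α * s := by positivity
    have hd : (0 : ℝ) ≤ d := d.cast_nonneg
    nlinarith [mul_nonneg hd h0]
  have hE : 51 * (L * α * s) ≤ 51 * (L ^ 2 * α * s) := by
    have h0 : 0 ≤ L * α * s := by positivity
    have : L ^ 2 * α * s = L * (L * α * s) := by ring
    rw [this]; nlinarith
  -- the vertical motion
  obtain ⟨ε, hε, hεx⟩ : ∃ ε : ℝ, |ε| = 1 ∧ z 1 - x 1 = |z 1 - x 1| * ε := by
    rcases le_total 0 (z 1 - x 1) with h | h
    · exact ⟨1, by simp, by rw [abs_of_nonneg h]; ring⟩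
    · exact ⟨-1, by simp, by rw [abs_of_nonpos h]; ring⟩
  set l := |z 1 - x 1| with hl
  have hl17 : l ≤ 17 * L * s := by rw [hl, abs_sub_comm]; exact hx1
  have hl0 : 0 ≤ l := abs_nonneg _
  have hαl : 3 * α * l ≤ 51 * (L * α * s) := by
    calc 3 * α * l ≤ 3 * α * (17 * L * s) := by gcongr
      _ = _ := by ring
  have hin : ∀ g : E3, |inner ℝ g (EuclideanSpace.single 1 ε)| = |g 1| := by
    intro g
    rw [EuclideanSpace.inner_single_right]
    simp [abs_mul, hε]
  obtain ⟨x', hx', hx'W, hx'n⟩ := exists_zero_of_slide P (x₀ := x)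
    (v := EuclideanSpace.single 1 ε) (c := 3 * α) (l := l) (by positivity) hl0 (coordKer 1) hx (by
      intro t y ht htl hy hyW hyn
      rw [mem_coordKer] at hyW
      have hc := fun i => (abs_coord_le_norm (y - x - t • EuclideanSpace.single 1 ε) i).trans hyn
      have hc0 := hc 0
      have hc2 := hc 2
      simp at hyW hc0 hc2
      have htl' : 3 * α * t ≤ 51 * (L * α * s) := le_trans (by gcongr) hαl
      have hy0 : |y 0 - z 0| ≤ 4 * r := by rw [← hx0]; linarith
      have hy2 : |y 2 - z 2| ≤ 4 * r := by
        have : y 2 - z 2 = (y 2 - x 2) + (x 2 - z 2) := by ring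
        rw [this]
        refine (abs_add_le _ _).trans ?_
        linarith
      have hy1 : |y 1 - z 1| ≤ 20 * L * s := by
        have : y 1 - z 1 = -((l - t) * ε) := by linarith
        rw [this, abs_neg, abs_mul, hε, abs_of_pos (by linarith)]
        have : 0 < L * s := by positivity
        linarith
      obtain ⟨ω, h1, h2, h3⟩ :=
        exists_correction_vertical hα hα1 (hsm y hy) (h.vertical y hy hy0 hy2 hy1)
      exact ⟨ω, h1, h2, by rw [hin]; exact h3⟩)
  rw [mem_coordKer] at hx'W
  have hc := fun i => (abs_coord_le_norm (x' - x - l • EuclideanSpace.single 1 ε) i).trans hx'n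
  have hc0 := hc 0
  have hc2 := hc 2
  simp at hx'W hc0 hc2
  have hx'1 : x' 1 = z 1 := by linarith
  -- the horizontal motion
  obtain ⟨ε', hε', hεx'⟩ : ∃ ε' : ℝ, |ε'| = 1 ∧ z 0 - x' 0 = |z 0 - x' 0| * ε' := by
    rcases le_total 0 (z 0 - x' 0) with h | h
    · exact ⟨1, by simp, by rw [abs_of_nonneg h]; ring⟩
    · exact ⟨-1, by simp, by rw [abs_of_nonpos h]; ring⟩
  set l' := |z 0 - x' 0| with hl'
  have hl'0 : 0 ≤ l' := abs_nonneg _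
  have hl'E : l' ≤ 51 * (L * α * s) := by
    rw [hl', abs_sub_comm, ← hx0]; linarith
  have hv2 : |v 2| ≤ 3 * L := (abs_coord_le_norm v 2).trans h.norm_dir_le
  have hcL : 50 * L ^ 2 * α ≤ L := by nlinarith
  have hmove : ∀ t y2 : ℝ, 0 ≤ t → t ≤ l' → |y2 - x' 2 - t * (ε' * v 2)| ≤ 50 * L ^ 2 * α * t →
      |y2 - x' 2| ≤ 4 * L * l' := by
    intro t y2 ht htl hy
    have h1 : |t * (ε' * v 2)| ≤ l' * (3 * L) := by
      rw [abs_mul, abs_mul, hε', one_mul, abs_of_nonneg ht]; gcongr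
    have h2 : 50 * L ^ 2 * α * t ≤ L * l' := by gcongr
    have : y2 - x' 2 = (y2 - x' 2 - t * (ε' * v 2)) + t * (ε' * v 2) := by ring
    rw [this]
    refine (abs_add_le _ _).trans ?_
    linarith
  have h4 : 4 * L * l' ≤ 204 * (L ^ 2 * α * s) := by
    calc 4 * L * l' ≤ 4 * L * (51 * (L * α * s)) := by gcongr
      _ = _ := by ring
  obtain ⟨y, hy, hyW, hyn⟩ := exists_zero_of_slide P (x₀ := x')
    (v := !₂[ε', 0, ε' * v 2]) (c := 50 * L ^ 2 * α) (l := l') (by positivity) hl'0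
    (coordKer 0 ⊓ coordKer 1) hx' (by
      intro t y ht htl hy hyW hyn
      rw [Submodule.mem_inf, mem_coordKer, mem_coordKer] at hyW
      have hc2' := (abs_coord_le_norm _ 2).trans hyn
      simp at hyW hc2'
      have hm := hmove t (y 2) ht htl.le hc2'
      have hy0 : |y 0 - z 0| ≤ 51 * (L * α * s) := by
        have : y 0 - z 0 = -((l' - t) * ε') := by linarith [hyW.1]
        rw [this, abs_neg, abs_mul, hε', abs_of_pos (by linarith)]
        linarith
      have hy1 : y 1 - z 1 = 0 := by linarith [hyW.2]
      have hy2 : |y 2 - z 2| ≤ 204 * (L ^ 2 * α * s) + 51 * (L * α * s) + r := by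
        have : y 2 - z 2 = (y 2 - x' 2) + (x' 2 - x 2) + (x 2 - z 2) := by ring
        rw [this]
        refine (abs_add_le _ _).trans (add_le_add ((abs_add_le _ _).trans ?_) hx2)
        linarith
      have hvert := h.vertical y hy (by linarith) (by linarith) (by
        rw [hy1, abs_zero]; positivity)
      have halong := h.along y 0 hy (by simpa using hs.le) (by
        rw [zero_smul, sub_zero]
        refine (norm_le_sum_abs_coord _).trans ?_
        simp only [PiLp.sub_apply, hy1, abs_zero]
        linarith)
      obtain ⟨h5, h6⟩ := norm_le_of_cross hL hα hLα h.dir_zero h.norm_dir_le halong hvert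
      have : inner ℝ (polyGrad P y) !₂[ε', 0, ε' * v 2]
          = ε' * (polyGrad P y 0 + polyGrad P y 2 * v 2) := by
        rw [inner_eq_coord]
        simp
        ring
      rw [this]
      refine exists_correction_horizontal hL hα (hsm y hy) ?_ h6
      rw [abs_mul, hε', one_mul]
      exact h5)
  rw [Submodule.mem_inf, mem_coordKer, mem_coordKer] at hyW
  have hc2' := (abs_coord_le_norm _ 2).trans hyn
  simp at hyW hc2'
  refine ⟨y, hy, by linarith [hyW.1], by linarith [hyW.2], ?_⟩
  have hm := hmove l' (y 2) hl'0 le_rfl hc2'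
  have : y 2 - x 2 = (y 2 - x' 2) + (x' 2 - x 2) := by ring
  rw [this]
  refine (abs_add_le _ _).trans ?_
  linarith

/-- Some pair of planes parallel to the first two axes, at distance between `r / 2` and `r` from
`z`, misses the surface within the slice `x 0 = z 0` and the relevant range of heights: otherwise
the line `{x 0 = z 0, x 1 = z 1}` would meet the surface in too many points. -/
theorem CrossTangent.exists_gap (h : CrossTangent P L α r s z v) (hd : P.totalDegree ≤ d)
    (hp : CellParameters d L α r s) (hsm : ∀ x, polyEval P x = 0 → polyGrad P x ≠ 0) :
    ∃ σ, r / 2 ≤ σ ∧ σ ≤ r ∧ ∀ x, polyEval P x = 0 → x 0 = z 0 → |x 1 - z 1| ≤ 17 * L * s →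
      |x 2 - z 2| ≠ σ := by
  by_contra hno
  push Not at hno
  have hr := hp.pos_radius
  have hs := hp.pos_side
  have hL := hp.one_le
  have hd0 : (0 : ℝ) < d + 1 := by positivity
  set σ : Fin (d + 1) → ℝ := fun k => r / 2 + (k : ℕ) * (r / (2 * (d + 1))) with hσ
  have hstep : 0 < r / (2 * ((d : ℝ) + 1)) := by positivity
  have hσ1 : ∀ k, r / 2 ≤ σ k := fun k => by
    simp only [hσ]
    linarith [mul_nonneg (Nat.cast_nonneg (α := ℝ) (k : ℕ)) hstep.le]
  have hσ2 : ∀ k, σ k ≤ r := by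
    intro k
    have hk : ((k : ℕ) : ℝ) ≤ d + 1 := by exact_mod_cast k.2.le
    have : ((k : ℕ) : ℝ) * (r / (2 * (d + 1))) ≤ (d + 1) * (r / (2 * (d + 1))) := by gcongr
    have e : ((d : ℝ) + 1) * (r / (2 * (d + 1))) = r / 2 := by field_simp
    simp only [hσ]
    linarith
  choose x hx hx0 hx1 hx2 using fun k => hno (σ k) (hσ1 k) (hσ2 k)
  choose y hy hy0 hy1 hy2 using fun k =>
    h.exists_zero_on_line hp hsm (hx k) (hx0 k) (hx1 k) (by rw [hx2]; exact hσ2 k)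
  have hline : ∀ k, z + (y k 2 - z 2) • EuclideanSpace.single 2 (1 : ℝ) = y k := by
    intro k
    ext i
    fin_cases i <;> simp [hy0, hy1]
  have hE : 255 * (L ^ 2 * α * s) < r / (2 * (d + 1)) / 2 := by
    have := hp.drift_le'.1
    rw [div_div, lt_div_iff₀ (by positivity)]
    have h0 : 0 < (d + 1) * (L ^ 2 * α * s) := by
      have := hp.pos_angle
      positivity
    nlinarith
  have hinj : Function.Injective fun k => y k 2 - z 2 := by
    intro k l hkl
    by_contra hne
    simp only [sub_left_inj] at hkl
    have h1 : |σ k - σ l| ≤ 2 * (255 * (L ^ 2 * α * s)) := by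
      rw [← hx2, ← hx2]
      refine (abs_abs_sub_abs_le_abs_sub _ _).trans ?_
      have : x k 2 - z 2 - (x l 2 - z 2) = -(y k 2 - x k 2) + (y l 2 - x l 2) := by rw [hkl]; ring
      rw [this]
      refine (abs_add_le _ _).trans ?_
      rw [abs_neg]
      linarith [hy2 k, hy2 l]
    have h2 : σ k - σ l = (((k : ℕ) : ℤ) - ((l : ℕ) : ℤ) : ℤ) * (r / (2 * (d + 1))) := by
      simp only [hσ]; push_cast; ring
    have h3 : (1 : ℝ) ≤ |((((k : ℕ) : ℤ) - ((l : ℕ) : ℤ) : ℤ) : ℝ)| := by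
      have : ((k : ℕ) : ℤ) - ((l : ℕ) : ℤ) ≠ 0 := fun h => hne (Fin.ext (by omega))
      exact_mod_cast Int.one_le_abs this
    rw [h2, abs_mul, abs_of_pos hstep] at h1
    nlinarith
  have hcard := card_zeros_on_line_le P hd z (EuclideanSpace.single 2 1)
    (Finset.univ.image fun k => y k 2 - z 2) (by
      intro τ hτ
      obtain ⟨k, -, rfl⟩ := Finset.mem_image.1 hτ
      rw [hline]
      exact hy k) (by
      by_contra hall
      push Not at hall
      have hder := hasDerivAt_polyEval_line P z (EuclideanSpace.single 2 1) 0
      have hzero : (fun τ : ℝ => polyEval P (z + τ • EuclideanSpace.single 2 1)) = fun _ => 0 :=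
        funext hall
      rw [hzero] at hder
      have h0 := hder.unique (hasDerivAt_const (0 : ℝ) (0 : ℝ))
      rw [zero_smul, add_zero, EuclideanSpace.inner_single_right] at h0
      have hvert := h.vertical z h.zero (by simpa using hr.le) (by simpa using hr.le) (by
        simp; positivity)
      have halong := h.along z 0 h.zero (by simpa using hs.le) (by simpa using hr.le)
      obtain ⟨-, h6⟩ := norm_le_of_cross hL hp.pos_angle hp.angle_le h.dir_zero h.norm_dir_le
        halong hvert
      have h7 : polyGrad P z 2 = 0 := by simpa using h0
      rw [h7, abs_zero, mul_zero] at h6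
      exact hsm z h.zero (norm_le_zero_iff.1 h6))
  rw [Finset.card_image_of_injective _ hinj, Finset.card_univ, Fintype.card_fin] at hcard
  omega

end Correction

/-! ### The plane through an earlier point -/

/-- `x` is a zero of `P` reached from `y` by a motion along `v` up to time `τ`, with exact `0`-th
coordinate and with error at most `c₁ τ`. -/
structure Follows (P : MvPolynomial (Fin 3) ℝ) (c₁ : ℝ) (y v : E3) (τ : ℝ) (x : E3) : Prop where
  zero : polyEval P x = 0
  mem : x - y - τ • v ∈ coordKer 0
  norm_le : ‖x - y - τ • v‖ ≤ c₁ * τ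

theorem isClosed_follows (P : MvPolynomial (Fin 3) ℝ) (c₁ : ℝ) (y v : E3) :
    IsClosed {p : ℝ × E3 | Follows P c₁ y v p.1 p.2} := by
  have h1 : IsClosed {p : ℝ × E3 | polyEval P p.2 = 0} :=
    isClosed_eq ((continuous_polyEval P).comp continuous_snd) continuous_const
  have h2 : IsClosed {p : ℝ × E3 | p.2 - y - p.1 • v ∈ coordKer 0} :=
    (Submodule.closed_of_finiteDimensional (coordKer 0)).preimage
      (f := fun p : ℝ × E3 => p.2 - y - p.1 • v) (by fun_prop)
  have h3 : IsClosed {p : ℝ × E3 | ‖p.2 - y - p.1 • v‖ ≤ c₁ * p.1} :=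
    isClosed_le (f := fun p : ℝ × E3 => ‖p.2 - y - p.1 • v‖)
      (g := fun p : ℝ × E3 => c₁ * p.1) (by fun_prop) (by fun_prop)
  convert h1.inter (h2.inter h3) using 1
  ext p
  exact ⟨fun h => ⟨h.1, h.2, h.3⟩, fun h => ⟨h.1, h.2.1, h.2.2⟩⟩

theorem Follows.coord_zero {P : MvPolynomial (Fin 3) ℝ} {c₁ τ : ℝ} {y v x : E3}
    (h : Follows P c₁ y v τ x) (hv : v 0 = 1) : x 0 = y 0 + τ := by
  have := mem_coordKer.1 h.mem
  simp [hv] at this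
  linarith

/-- Two points of the surface in the same quasi-component of a slice can be moved simultaneously
along two directions; as long as the slices are regular they stay in the same quasi-component. -/
theorem exists_unseparated_slide {P Q : MvPolynomial (Fin 3) ℝ} {t c l c₁ : ℝ} (hl : 0 ≤ l)
    (hc₁ : 0 ≤ c₁) (hcpt : ∀ M, IsCompact {x : E3 | |x 0| ≤ M ∧ polyEval Q x ≤ t})
    (hreg : ∀ c' ∈ Set.Icc c (c + l), RegularSlice Q t c') {y v : Fin 2 → E3}
    (hv : ∀ k, v k 0 = 1) (hy : ∀ k, y k 0 = c) (hyz : ∀ k, polyEval P (y k) = 0)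
    (hstep : ∀ k τ x, 0 ≤ τ → τ ≤ l → Follows P c₁ (y k) (v k) τ x → polyEval Q x ≤ t ∧
      ∃ ω ∈ coordKer 0, ‖ω‖ ≤ 1 ∧
        |inner ℝ (polyGrad P x) (v k)| < c₁ * inner ℝ (polyGrad P x) ω)
    (hun : Unseparated (slice Q t c) (y 0) (y 1)) :
    ∃ x₁ x₂, Follows P c₁ (y 0) (v 0) l x₁ ∧ Follows P c₁ (y 1) (v 1) l x₂ ∧
      Unseparated (slice Q t (c + l)) x₁ x₂ := by
  let D : Set (ℝ × E3 × E3) := {p | (0 ≤ p.1 ∧ p.1 ≤ l) ∧ Follows P c₁ (y 0) (v 0) p.1 p.2.1 ∧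
    Follows P c₁ (y 1) (v 1) p.1 p.2.2}
  have hD : IsClosed D := by
    refine IsClosed.inter ?_ (IsClosed.inter ?_ ?_)
    · exact (isClosed_le continuous_const continuous_fst).inter
        (isClosed_le continuous_fst continuous_const)
    · exact (isClosed_follows P c₁ (y 0) (v 0)).preimage
        (f := fun p : ℝ × E3 × E3 => (p.1, p.2.1)) (by fun_prop)
    · exact (isClosed_follows P c₁ (y 1) (v 1)).preimage
        (f := fun p : ℝ × E3 × E3 => (p.1, p.2.2)) (by fun_prop)
  have hsl : ∀ k τ x, 0 ≤ τ → τ ≤ l → Follows P c₁ (y k) (v k) τ x → x ∈ slice Q t (c + τ) :=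
    fun k τ x h0 h1 h => ⟨by rw [h.coord_zero (hv k), hy], (hstep k τ x h0 h1 h).1⟩
  let A : Set (ℝ × E3 × E3) := {p | p ∈ D ∧ Unseparated (slice Q t (c + p.1)) p.2.1 p.2.2}
  have hshift : Continuous fun p : ℝ × E3 × E3 => (c + p.1, p.2) := by fun_prop
  have hA : IsClosed A := by
    rw [isClosed_iff_frequently]
    intro p hp
    have hpD : p ∈ D := isClosed_iff_frequently.1 hD p (hp.mono fun q hq => hq.1)
    refine ⟨hpD, ?_⟩
    by_contra hn
    have hev := eventually_not_unseparated Q hcpt (hsl 0 _ _ hpD.1.1 hpD.1.2 hpD.2.1)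
      (hsl 1 _ _ hpD.1.1 hpD.1.2 hpD.2.2) hn
    exact hp (((hshift.tendsto p).eventually hev).mono fun q hq hqA => hq hqA.2)
  obtain ⟨⟨x₁, x₂⟩, hx, hxu⟩ := exists_of_continuation (A := A)
    (K := Metric.closedBall (y 0) (c₁ * l + l * ‖v 0‖) ×ˢ
      Metric.closedBall (y 1) (c₁ * l + l * ‖v 1‖)) hl hA
    ((isCompact_closedBall _ _).prod (isCompact_closedBall _ _)) (by
      have hb : ∀ k τ x, 0 ≤ τ → τ ≤ l → Follows P c₁ (y k) (v k) τ x →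
          x ∈ Metric.closedBall (y k) (c₁ * l + l * ‖v k‖) := by
        intro k τ x h0 h1 h
        rw [Metric.mem_closedBall, dist_eq_norm]
        calc ‖x - y k‖ = ‖(x - y k - τ • v k) + τ • v k‖ := by congr 1; abel
          _ ≤ ‖x - y k - τ • v k‖ + ‖τ • v k‖ := norm_add_le _ _
          _ ≤ c₁ * l + l * ‖v k‖ := by
            rw [norm_smul, Real.norm_of_nonneg h0]; gcongr
            exact h.norm_le.trans (by gcongr)
      rintro p ⟨hp, -⟩ h0 h1
      exact ⟨hb 0 _ _ h0 h1 hp.2.1, hb 1 _ _ h0 h1 hp.2.2⟩)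
    ⟨(y 0, y 1), ⟨⟨le_rfl, hl⟩, ⟨hyz 0, by simp, by simp⟩, ⟨hyz 1, by simp, by simp⟩⟩,
      by simpa using hun⟩ (by
    rintro ⟨τ, x₁, x₂⟩ ⟨⟨⟨h0, h1⟩, hx₁, hx₂⟩, hu⟩ - hτl
    simp only at h0 h1 hx₁ hx₂ hu hτl
    have hs₁ := hsl 0 _ _ h0 h1 hx₁
    obtain ⟨-, ω₁, hω₁, hn₁, hlt₁⟩ := hstep 0 _ _ h0 h1 hx₁
    obtain ⟨-, ω₂, hω₂, hn₂, hlt₂⟩ := hstep 1 _ _ h0 h1 hx₂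
    have hcs : IsCompact (slice Q t (c + τ)) := (hcpt |c + τ|).of_isClosed_subset
      (isClosed_slice Q t _) fun x hx => ⟨by rw [hx.1], hx.2⟩
    have hev := eventually_unseparated Q (hreg (c + τ) ⟨by linarith, by linarith⟩) hcs hs₁ hu
    obtain ⟨ε, hε, hball⟩ := Metric.eventually_nhds_iff.1 hev
    have e₁ := eventually_exists_zero P hc₁ hx₁.zero hlt₁
    have e₂ := eventually_exists_zero P hc₁ hx₂.zero hlt₂
    set M := 1 + ‖v 0‖ + ‖v 1‖ + c₁ with hM
    have hM0 : 0 < M := by positivity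
    have e₃ : ∀ᶠ κ in 𝓝[>] (0 : ℝ), κ < min (l - τ) (ε / M) :=
      (eventually_lt_nhds (lt_min (by linarith) (by positivity))).filter_mono nhdsWithin_le_nhds
    obtain ⟨κ, ⟨⟨⟨θ₁, hθ₁, hz₁⟩, θ₂, hθ₂, hz₂⟩, hκ⟩, hκ0⟩ :=
      (((e₁.and e₂).and e₃).and self_mem_nhdsWithin).exists
    have hκ0' : (0 : ℝ) < κ := hκ0
    have hκl : κ < l - τ := hκ.trans_le (min_le_left _ _)
    have hκε : κ * M < ε := by
      have := hκ.trans_le (min_le_right _ _)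
      rwa [lt_div_iff₀ hM0] at this
    have hfol : ∀ k (x ω : E3) (θ : ℝ), Follows P c₁ (y k) (v k) τ x → ω ∈ coordKer 0 → ‖ω‖ ≤ 1 →
        |θ| ≤ c₁ → polyEval P (x + κ • (v k + θ • ω)) = 0 →
        Follows P c₁ (y k) (v k) (τ + κ) (x + κ • (v k + θ • ω)) := by
      intro k x ω θ hx hω hn hθ hz
      have e : x + κ • (v k + θ • ω) - y k - (τ + κ) • v k
          = (x - y k - τ • v k) + (κ * θ) • ω := by module
      refine ⟨hz, ?_, ?_⟩
      · rw [e]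
        exact Submodule.add_mem _ hx.mem (Submodule.smul_mem _ _ hω)
      · rw [e]
        refine (norm_add_le _ _).trans ?_
        rw [norm_smul, Real.norm_eq_abs, abs_mul, abs_of_pos hκ0']
        have : κ * |θ| * ‖ω‖ ≤ κ * c₁ * 1 := by gcongr
        linarith [hx.norm_le]
    have hdist : ∀ k (x ω : E3) (θ : ℝ), ‖ω‖ ≤ 1 → |θ| ≤ c₁ →
        dist (x + κ • (v k + θ • ω)) x < ε := by
      intro k x ω θ hn hθ
      rw [dist_eq_norm, add_sub_cancel_left, norm_smul, Real.norm_of_nonneg hκ0'.le]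
      refine lt_of_le_of_lt ?_ hκε
      gcongr
      refine (norm_add_le _ _).trans ?_
      rw [norm_smul, Real.norm_eq_abs]
      have h5 : |θ| * ‖ω‖ ≤ c₁ * 1 := by gcongr
      have h6 : ‖v k‖ ≤ ‖v 0‖ + ‖v 1‖ := by
        fin_cases k <;> simp
      linarith
    have f₁ := hfol 0 x₁ ω₁ θ₁ hx₁ hω₁ hn₁ hθ₁ hz₁
    have f₂ := hfol 1 x₂ ω₂ θ₂ hx₂ hω₂ hn₂ hθ₂ hz₂
    refine ⟨τ + κ, by simp only; linarith, by linarith, (_, _),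
      ⟨⟨by simp only; linarith, by simp only; linarith⟩, f₁, f₂⟩, ?_⟩
    simp only
    have := hball (y := (c + (τ + κ), x₁ + κ • (v 0 + θ₁ • ω₁), x₂ + κ • (v 1 + θ₂ • ω₂))) (by
      rw [Prod.dist_eq, Prod.dist_eq]
      refine max_lt ?_ (max_lt (hdist 0 _ _ _ hn₁ hθ₁) (hdist 1 _ _ _ hn₂ hθ₂))
      simp only [Real.dist_eq]
      have : c + (τ + κ) - (c + τ) = κ := by ring
      rw [this, abs_of_pos hκ0']
      refine lt_of_le_of_lt ?_ hκε
      have : 0 ≤ ‖v 0‖ + ‖v 1‖ + c₁ := by positivity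
      nlinarith)
    exact this (hsl 0 _ _ (by linarith) (by linarith) f₁) (hsl 1 _ _ (by linarith) (by linarith) f₂))
  exact ⟨x₁, x₂, hx.2.1, hx.2.2, hxu⟩

/-- The bound for the number of essentially different planes in one cell. -/
def cellPlaneBound (d : ℕ) : ℕ := (criticalValueBound d + 1) * (2 * d + 1) ^ 2

section Cell

variable {P : MvPolynomial (Fin 3) ℝ} {d : ℕ} {L α r s : ℝ} {z v : E3}

/-- Near the line through `z` in the direction `v` the correction of a motion along `v` is slow. -/
theorem CrossTangent.exists_correction (h : CrossTangent P L α r s z v)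
    (hp : CellParameters d L α r s) (hsm : ∀ x, polyEval P x = 0 → polyGrad P x ≠ 0) {x : E3} {τ : ℝ}
    (hx : polyEval P x = 0) (hτ : |τ| ≤ s) (hxz : ‖x - z - τ • v‖ ≤ 4 * r) :
    ∃ ω ∈ coordKer 0, ‖ω‖ ≤ 1 ∧
      |inner ℝ (polyGrad P x) v| < 100 * L ^ 3 * α * inner ℝ (polyGrad P x) ω :=
  exists_correction_along hp.one_le hp.pos_angle hp.angle_le (hsm x hx) h.dir_zero h.norm_dir_le
    (h.along x τ hx hτ hxz)

theorem CrossTangent.abs_coord_le (h : CrossTangent P L α r s z v)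
    (hp : CellParameters d L α r s) {x : E3} {τ : ℝ} (hτ : |τ| ≤ s)
    (hxz : ‖x - z - τ • v‖ ≤ 4 * r) (k : Fin 3) : |x k| ≤ 8 * L * s := by
  have h1 := (abs_coord_le_norm _ k).trans hxz
  have h2 := h.coord_le k
  have h3 : |τ * v k| ≤ s * (3 * L) := by
    rw [abs_mul]
    exact mul_le_mul hτ ((abs_coord_le_norm v k).trans h.norm_dir_le) (abs_nonneg _) hp.pos_side.le
  simp only [PiLp.sub_apply, PiLp.smul_apply, smul_eq_mul] at h1
  have e : x k = (x k - z k - τ * v k) + z k + τ * v k := by ring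
  rw [e]
  refine (abs_add_le _ _).trans ?_
  have h4 := abs_add_le (x k - z k - τ * v k) (z k)
  have := hp.radius_le
  have hL := hp.one_le
  have hs := hp.pos_side
  nlinarith

/-- The point of the surface reached from `z` by moving backwards along `v` to the plane
`x 0 = c`. -/
theorem CrossTangent.exists_back (h : CrossTangent P L α r s z v)
    (hp : CellParameters d L α r s) (hsm : ∀ x, polyEval P x = 0 → polyGrad P x ≠ 0) {c : ℝ}
    (hc : c ≤ z 0) (hcs : z 0 - c ≤ s) :
    ∃ y, polyEval P y = 0 ∧ y 0 = c ∧ ‖y - z - (c - z 0) • v‖ ≤ 100 * L ^ 3 * α * s := by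
  have hα := hp.pos_angle
  have hL := hp.one_le
  have hr := hp.pos_radius
  have hdr := hp.drift_le'.2
  have hc₁ : 0 ≤ 100 * L ^ 3 * α := by positivity
  obtain ⟨y, hy, hyW, hyn⟩ := exists_zero_of_slide P (x₀ := z) (v := -v)
    (c := 100 * L ^ 3 * α) (l := z 0 - c) hc₁ (by linarith) (coordKer 0) h.zero (by
      intro τ x h0 h1 hx _ hxn
      have e : x - z - τ • -v = x - z - (-τ) • v := by module
      rw [e] at hxn
      obtain ⟨ω, h2, h3, h4⟩ := h.exists_correction hp hsm hx (τ := -τ)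
        (by rw [abs_neg, abs_of_nonneg h0]; linarith) (hxn.trans (by
          have : 100 * L ^ 3 * α * τ ≤ 100 * L ^ 3 * α * s := by gcongr; linarith
          linarith))
      exact ⟨ω, h2, h3, by rw [inner_neg_right, abs_neg]; exact h4⟩)
  have e : y - z - (z 0 - c) • -v = y - z - (c - z 0) • v := by module
  rw [e] at hyW hyn
  refine ⟨y, hy, ?_, hyn.trans (by gcongr)⟩
  have := mem_coordKer.1 hyW
  simp [h.dir_zero] at this
  linarith

/-- The key estimate: among more than `cellPlaneBound d` points of one cell at which the surface is
tangential to two tubes, some point is close to the plane through an earlier one. -/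
theorem exists_close_to_plane (hd : P.totalDegree ≤ d) (hp : CellParameters d L α r s)
    (hsm : ∀ x, polyEval P x = 0 → polyGrad P x ≠ 0) {N : ℕ} (hN : cellPlaneBound d < N)
    (z v : Fin N → E3) (h : ∀ i, CrossTangent P L α r s (z i) (v i)) :
    ∃ i j, i < j ∧ |z j 2 - z i 2 - (z j 0 - z i 0) * v i 2| ≤ 2 * r := by
  classical
  have hα := hp.pos_angle
  have hL := hp.one_le
  have hr := hp.pos_radius
  have hs := hp.pos_side
  have hdr := hp.drift_le'.2
  have hLs : 0 < L * s := by positivity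
  set c₁ := 100 * L ^ 3 * α with hc₁
  have hc₁0 : 0 ≤ c₁ := by positivity
  have hc₁s : c₁ * s ≤ r / 20 := by rw [hc₁]; linarith
  have hNe : Nonempty (Fin N) := ⟨⟨0, by omega⟩⟩
  -- the gaps, and a positive lower bound for `P ^ 2` on them
  choose σ hσ1 hσ2 hσ using fun j => (h j).exists_gap hd hp hsm
  let K : Fin N → Set E3 := fun j =>
    {x | x 0 = z j 0 ∧ |x 1 - z j 1| ≤ 17 * L * s ∧ |x 2 - z j 2| = σ j}
  have hK : ∀ j, IsCompact (K j) := by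
    intro j
    refine Metric.isCompact_of_isClosed_isBounded ?_ ?_
    · exact (isClosed_eq (continuous_coord 0) continuous_const).inter ((isClosed_le
        ((continuous_coord 1).sub continuous_const).abs continuous_const).inter
        (isClosed_eq ((continuous_coord 2).sub continuous_const).abs continuous_const))
    · refine (Metric.isBounded_closedBall (x := z j) (r := 17 * L * s + σ j)).subset ?_
      rintro x ⟨h0, h1, h2⟩
      rw [Metric.mem_closedBall, dist_eq_norm]
      refine (norm_le_sum_abs_coord _).trans ?_
      simp only [PiLp.sub_apply, h0, sub_self, abs_zero, h2]
      linarith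
  have hm : ∀ j, ∃ m > 0, ∀ x ∈ K j, m ≤ polyEval P x ^ 2 := by
    intro j
    rcases (K j).eq_empty_or_nonempty with he | hne
    · exact ⟨1, one_pos, by simp [he]⟩
    · obtain ⟨x, hx, hmin⟩ := (hK j).exists_isMinOn hne
        ((continuous_polyEval P).pow 2).continuousOn
      refine ⟨polyEval P x ^ 2, ?_, fun y hy => hmin hy⟩
      have : polyEval P x ≠ 0 := fun h0 => hσ j x h0 hx.1 hx.2.1 hx.2.2
      positivity
  choose m hm0 hmK using hm
  obtain ⟨j₀, hj₀⟩ := Finite.exists_min m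
  -- the points that occur in the motions have coordinates at most `ρ`, so that the confining term
  -- of `Q` is at most `2 η ρ ^ (2d+2) < t` there, while `Q > t` on the gaps
  set ρ := 8 * L * s with hρ
  have hρ0 : 0 < ρ := by positivity
  have hρp : 0 < ρ ^ (2 * d + 2) := by positivity
  set η := m j₀ / (6 * ρ ^ (2 * d + 2)) with hη
  have hη0 : 0 < η := div_pos (hm0 j₀) (by positivity)
  have hηρ : 3 * η * ρ ^ (2 * d + 2) < m j₀ := by
    have e : 3 * η * ρ ^ (2 * d + 2) = m j₀ / 2 := by
      rw [hη]; field_simp; ring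
    rw [e]; linarith [hm0 j₀]
  set Q := confine P d η with hQ
  obtain ⟨bad, hbad⟩ := exists_criticalValues hd hη0
  obtain ⟨t, ⟨ht2, ht3⟩, htbad⟩ : ∃ t, t ∈ Set.Ioo (2 * η * ρ ^ (2 * d + 2))
      (3 * η * ρ ^ (2 * d + 2)) ∧ t ∉ (bad : Set ℝ) ∪ ⋃ j : Fin N,
        {t | ∃ x ∈ sliceCritical Q, x 0 = z j 0 ∧ polyEval Q x = t} := by
    have hfin : ((bad : Set ℝ) ∪ ⋃ j : Fin N,
        {t | ∃ x ∈ sliceCritical Q, x 0 = z j 0 ∧ polyEval Q x = t}).Finite :=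
      bad.finite_toSet.union (Set.finite_iUnion fun j => finite_critical_levels hd hη0 (z j 0))
    have hlt : 2 * η * ρ ^ (2 * d + 2) < 3 * η * ρ ^ (2 * d + 2) := by
      nlinarith [mul_pos hη0 hρp]
    obtain ⟨t, h1, h2⟩ := ((Set.Ioo_infinite hlt).sdiff hfin).nonempty
    exact ⟨t, h1, h2⟩
  simp only [Set.mem_union, Set.mem_iUnion, not_or, not_exists] at htbad
  obtain ⟨V, hVc, hV⟩ := hbad t htbad.1
  have hregz : ∀ j, RegularSlice Q t (z j 0) := fun j =>
    regularSlice_of_forall fun x hx hxt hx0 => htbad.2 j ⟨x, hx, hx0, hxt⟩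
  have hregV : ∀ c, c ∉ V → RegularSlice Q t c := fun c hc =>
    regularSlice_of_forall fun x hx hxt hx0 => hc (hx0 ▸ hV x hx hxt)
  have hcpt : ∀ M, IsCompact {x : E3 | |x 0| ≤ M ∧ polyEval Q x ≤ t} :=
    isCompact_confine_le hη0 hρ0.le ht3.le
  have hscpt : ∀ c, IsCompact (slice Q t c) := fun c => (hcpt |c|).of_isClosed_subset
    (isClosed_slice Q t c) fun x hx => ⟨by rw [hx.1], hx.2⟩
  have hQle : ∀ i x τ, polyEval P x = 0 → |τ| ≤ s → ‖x - z i - τ • v i‖ ≤ 4 * r →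
      polyEval Q x ≤ t := by
    intro i x τ hx hτ hxz
    have hb := fun k => (h i).abs_coord_le hp hτ hxz k
    have he : Even (2 * d + 2) := ⟨d + 1, by ring⟩
    have h1 : x 1 ^ (2 * d + 2) ≤ ρ ^ (2 * d + 2) := by
      rw [← he.pow_abs]; exact pow_le_pow_left₀ (abs_nonneg _) (hb 1) _
    have h2 : x 2 ^ (2 * d + 2) ≤ ρ ^ (2 * d + 2) := by
      rw [← he.pow_abs]; exact pow_le_pow_left₀ (abs_nonneg _) (hb 2) _
    rw [hQ, polyEval_confine, hx]
    nlinarith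
  -- many points lie in one interval of regular values
  obtain ⟨q, -, hq⟩ := Finset.exists_lt_card_fiber_of_mul_lt_card_of_maps_to
    (s := (Finset.univ : Finset (Fin N))) (t := Finset.range (criticalValueBound d + 1))
    (f := fun j => (V.filter (· < z j 0)).card) (n := (2 * d + 1) ^ 2)
    (fun j _ => Finset.mem_range.2
      (Nat.lt_succ_of_le ((Finset.card_filter_le _ _).trans hVc)))
    (by simpa [cellPlaneBound] using hN)
  set S := Finset.univ.filter fun j => (V.filter (· < z j 0)).card = q with hS
  have hSne : S.Nonempty := Finset.card_pos.1 (by omega)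
  obtain ⟨i₀, hi₀, hmin⟩ := S.exists_min_image (fun j => z j 0) hSne
  set c := z i₀ 0 with hc
  have hspan : ∀ j, z j 0 - c ≤ s := by
    intro j
    have h1 := (abs_le.1 ((h j).coord_le 0)).2
    have h2 := (abs_le.1 ((h i₀).coord_le 0)).1
    rw [hc]
    linarith
  have hregI : ∀ j ∈ S, ∀ c' ∈ Set.Icc c (z j 0), RegularSlice Q t c' := by
    intro j hj c' hc'
    rcases eq_or_lt_of_le hc'.2 with he | hlt
    · rw [he]; exact hregz j
    refine hregV c' fun hmem => ?_
    have h1 := (Finset.mem_filter.1 hj).2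
    have h2 := (Finset.mem_filter.1 hi₀).2
    have hsub : V.filter (· < c) ⊆ V.filter (· < z j 0) := by
      intro a ha
      rw [Finset.mem_filter] at ha ⊢
      exact ⟨ha.1, ha.2.trans_le (hc'.1.trans hc'.2)⟩
    have heq := Finset.eq_of_subset_of_card_le hsub (by rw [h1, hc, h2])
    have : c' ∈ V.filter (· < c) := by
      rw [heq, Finset.mem_filter]
      exact ⟨hmem, hlt⟩
    exact absurd (Finset.mem_filter.1 this).2 (not_lt.2 hc'.1)
  have hyex : ∀ j : S, ∃ y, polyEval P y = 0 ∧ y 0 = c ∧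
      ‖y - z j - (c - z j 0) • v j‖ ≤ c₁ * s := fun j =>
    (h j).exists_back hp hsm (hmin j j.2) (hspan j)
  choose y hy0 hyc hyn using hyex
  have habs : ∀ j : S, |c - z j 0| ≤ s := by
    intro j
    rw [abs_sub_comm, abs_of_nonneg (by linarith [hmin j j.2])]
    exact hspan j
  have hysl : ∀ j : S, y j ∈ slice Q t c := fun j =>
    ⟨hyc j, hQle j (y j) (c - z j 0) (hy0 j) (habs j) ((hyn j).trans (by linarith))⟩
  -- two of them lie in the same quasi-component
  obtain ⟨i, j, hij, hunij⟩ : ∃ i j : S, (i : Fin N) < j ∧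
      Unseparated (slice Q t c) (y i) (y j) := by
    by_contra hno
    push Not at hno
    have hcard := card_le_of_separated hd hη0 (hscpt c) (fun k => y (S.equivFin.symm k))
      (fun k => hysl _) (by
        intro k l hkl hun
        have hne : S.equivFin.symm k ≠ S.equivFin.symm l := fun he =>
          hkl (S.equivFin.symm.injective he)
        rcases lt_or_gt_of_ne (fun he => hne (Subtype.ext he)) with hlt | hlt
        · exact hno _ _ hlt hun
        · exact hno _ _ hlt (hun.symm (hysl _) (hysl _)))
    omega
  refine ⟨i, j, hij, ?_⟩
  have hl0 : 0 ≤ z j 0 - c := by linarith [hmin j j.2]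
  have hcl : c + (z j 0 - c) = z j 0 := by ring
  have hfollow : ∀ (k : S) (τ : ℝ) (x : E3), 0 ≤ τ → τ ≤ z j 0 - c →
      Follows P c₁ (y k) (v k) τ x →
      ‖x - z k - (c + τ - z k 0) • v k‖ ≤ r / 10 := by
    intro k τ x h0 h1 hf
    have e : x - z k - (c + τ - z k 0) • v k
        = (x - y k - τ • v k) + (y k - z k - (c - z k 0) • v k) := by module
    rw [e]
    refine (norm_add_le _ _).trans ?_
    have h2 : c₁ * τ ≤ c₁ * s := by
      gcongr
      linarith [hspan j]
    linarith [hf.norm_le, hyn k]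
  have hstepk : ∀ (k : S) (τ : ℝ) (x : E3), 0 ≤ τ → τ ≤ z j 0 - c →
      Follows P c₁ (y k) (v k) τ x → polyEval Q x ≤ t ∧ ∃ ω ∈ coordKer 0, ‖ω‖ ≤ 1 ∧
        |inner ℝ (polyGrad P x) (v k)| < c₁ * inner ℝ (polyGrad P x) ω := by
    intro k τ x h0 h1 hf
    have hn := hfollow k τ x h0 h1 hf
    have hτ : |c + τ - z k 0| ≤ s := by
      have h3 := (abs_le.1 (habs k)).1
      have h4 := (abs_le.1 ((h k).coord_le 0)).1
      have h5 := (abs_le.1 ((h j).coord_le 0)).2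
      rw [abs_le]
      constructor <;> linarith
    exact ⟨hQle k x _ hf.zero hτ (hn.trans (by linarith)),
      (h k).exists_correction hp hsm hf.zero hτ (hn.trans (by linarith))⟩
  obtain ⟨x₁, x₂, hx₁, hx₂, hun⟩ := exists_unseparated_slide (P := P) (Q := Q) (t := t) (c := c)
    (l := z j 0 - c) (y := ![y i, y j]) (v := ![v i, v j]) hl0 hc₁0 hcpt
    (by rw [hcl]; exact hregI j j.2)
    (by intro k; fin_cases k <;> simp [(h _).dir_zero])
    (by intro k; fin_cases k <;> simp [hyc])
    (by intro k; fin_cases k <;> simp [hy0])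
    (by
      intro k τ x h0 h1 hf
      fin_cases k
      · exact hstepk i τ x h0 h1 hf
      · exact hstepk j τ x h0 h1 hf) hunij
  rw [hcl] at hun
  have hn₁ := hfollow i _ x₁ hl0 le_rfl hx₁
  have hn₂ := hfollow j _ x₂ hl0 le_rfl hx₂
  rw [hcl] at hn₁ hn₂
  have hx₁s : x₁ ∈ slice Q t (z j 0) := by
    refine ⟨?_, (hstepk i _ x₁ hl0 le_rfl hx₁).1⟩
    rw [hx₁.coord_zero (by simp [(h _).dir_zero])]
    simp [hyc]
  have hx₂s : x₂ ∈ slice Q t (z j 0) := by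
    refine ⟨?_, (hstepk j _ x₂ hl0 le_rfl hx₂).1⟩
    rw [hx₂.coord_zero (by simp [(h _).dir_zero])]
    simp [hyc]
  have hx₂U : |x₂ 2 - z j 2| < σ j := by
    have := (abs_coord_le_norm _ 2).trans hn₂
    simp at this
    linarith [hσ1 j]
  have hcont : Continuous fun x : E3 => |x 2 - z j 2| :=
    ((continuous_coord 2).sub continuous_const).abs
  have hx₁U : |x₁ 2 - z j 2| < σ j := by
    refine (hun.symm hx₁s hx₂s) {x | |x 2 - z j 2| < σ j} {x | σ j < |x 2 - z j 2|}
      (isOpen_lt hcont continuous_const) (isOpen_lt continuous_const hcont) ?_ ?_ hx₂U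
    · intro x hx
      rcases lt_trichotomy (|x 2 - z j 2|) (σ j) with hlt | heq | hgt
      · exact Or.inl hlt
      · exfalso
        have hx1 := abs_coord_le_of_confine_le hη0 hρ0.le ht3.le hx.2 1 (by decide)
        have hz1 := (h j).coord_le 1
        have hxK : x ∈ K j := by
          refine ⟨hx.1, ?_, heq⟩
          refine (abs_sub _ _).trans ?_
          rw [hρ] at hx1
          nlinarith
        have h1 := hmK j x hxK
        have h2 := hx.2
        rw [hQ, polyEval_confine] at h2
        have he : Even (2 * d + 2) := ⟨d + 1, by ring⟩
        have h3 : 0 ≤ η * (x 1 ^ (2 * d + 2) + x 2 ^ (2 * d + 2)) :=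
          mul_nonneg hη0.le (add_nonneg (he.pow_nonneg _) (he.pow_nonneg _))
        linarith [hj₀ j]
      · exact Or.inr hgt
    · intro x _ h1 h2
      have h1' : |x 2 - z j 2| < σ j := h1
      have h2' : σ j < |x 2 - z j 2| := h2
      exact lt_asymm h1' h2'
  have hfin := (abs_coord_le_norm _ 2).trans hn₁
  simp only [PiLp.sub_apply, PiLp.smul_apply, smul_eq_mul] at hfin
  have e : z j 2 - z i 2 - (z j 0 - z i 0) * v i 2
      = (x₁ 2 - z i 2 - (z j 0 - z i 0) * v i 2) - (x₁ 2 - z j 2) := by ring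
  rw [e]
  refine (abs_sub _ _).trans ?_
  linarith [hσ2 j]

end Cell

/-! ### Change of coordinates -/

/-- The polynomial `P` in the coordinates of the frame with origin `o` and orthonormal basis `b`. -/
def framePoly (b : OrthonormalBasis (Fin 3) ℝ E3) (o : E3) (P : MvPolynomial (Fin 3) ℝ) :
    MvPolynomial (Fin 3) ℝ :=
  MvPolynomial.aeval (fun j => MvPolynomial.C (o j) +
    ∑ i, MvPolynomial.C (b i j) * MvPolynomial.X i) P

theorem totalDegree_framePoly_le (b : OrthonormalBasis (Fin 3) ℝ E3) (o : E3)
    {P : MvPolynomial (Fin 3) ℝ} {d : ℕ} (hd : P.totalDegree ≤ d) :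
    (framePoly b o P).totalDegree ≤ d := by
  rw [framePoly, MvPolynomial.aeval_def, MvPolynomial.eval₂_eq]
  refine MvPolynomial.totalDegree_finsetSum_le fun s hs => ?_
  refine (MvPolynomial.totalDegree_mul _ _).trans ?_
  rw [MvPolynomial.algebraMap_eq, MvPolynomial.totalDegree_C, zero_add]
  refine (MvPolynomial.totalDegree_finsetProd _ _).trans ?_
  refine le_trans ?_ ((MvPolynomial.le_totalDegree hs).trans hd)
  refine Finset.sum_le_sum fun j _ => ?_
  refine (MvPolynomial.totalDegree_pow _ _).trans ?_
  refine (Nat.mul_le_mul_left _ (?_ : _ ≤ 1)).trans (by rw [mul_one])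
  refine (MvPolynomial.totalDegree_add _ _).trans (max_le (by simp) ?_)
  refine MvPolynomial.totalDegree_finsetSum_le fun i _ => ?_
  refine (MvPolynomial.totalDegree_mul _ _).trans ?_
  simp

theorem polyEval_framePoly (b : OrthonormalBasis (Fin 3) ℝ E3) (o : E3)
    (P : MvPolynomial (Fin 3) ℝ) (y : E3) :
    polyEval (framePoly b o P) y = polyEval P (o + b.repr.symm y) := by
  have h : ∀ j, (o + b.repr.symm y) j = o j + ∑ i, b i j * y i := by
    intro j
    rw [PiLp.add_apply, ← b.sum_repr_symm]
    simp [mul_comm]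
  simp only [polyEval, framePoly, MvPolynomial.aeval_def]
  rw [MvPolynomial.algebraMap_eq, MvPolynomial.eval, MvPolynomial.coe_eval₂Hom,
    ← MvPolynomial.coe_eval₂Hom (RingHom.id ℝ), MvPolynomial.hom_eval₂]
  congr 1
  · ext; simp
  · funext j
    rw [h]
    simp

theorem inner_polyGrad_framePoly (b : OrthonormalBasis (Fin 3) ℝ E3) (o : E3)
    (P : MvPolynomial (Fin 3) ℝ) (y v : E3) :
    inner ℝ (polyGrad (framePoly b o P) y) v
      = inner ℝ (polyGrad P (o + b.repr.symm y)) (b.repr.symm v) := by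
  have h1 := hasDerivAt_polyEval_line (framePoly b o P) y v 0
  have h2 := hasDerivAt_polyEval_line P (o + b.repr.symm y) (b.repr.symm v) 0
  have e : (fun τ : ℝ => polyEval (framePoly b o P) (y + τ • v))
      = fun τ : ℝ => polyEval P (o + b.repr.symm y + τ • b.repr.symm v) := by
    funext τ
    rw [polyEval_framePoly, map_add, map_smul, add_assoc]
  rw [e] at h1
  simpa using h1.unique h2

theorem polyGrad_framePoly (b : OrthonormalBasis (Fin 3) ℝ E3) (o : E3)
    (P : MvPolynomial (Fin 3) ℝ) (y : E3) :
    polyGrad (framePoly b o P) y = b.repr (polyGrad P (o + b.repr.symm y)) := by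
  refine ext_inner_right ℝ fun v => ?_
  rw [inner_polyGrad_framePoly, ← b.repr.inner_map_map, LinearIsometryEquiv.apply_symm_apply]

/-! ### Planes with a given normal -/

/-- The plane `{x | ⟪x, n⟫ = τ}` with unit normal `n`. -/
def levelPlane (n : E3) (τ : ℝ) : AffineSubspace ℝ E3 :=
  AffineSubspace.mk' (τ • n) (Submodule.span ℝ {n})ᗮ

theorem isPlane_levelPlane {n : E3} (hn : ‖n‖ = 1) (τ : ℝ) : IsPlane (levelPlane n τ) := by
  refine ⟨AffineSubspace.mk'_nonempty _ _, ?_⟩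
  have : Fact (Module.finrank ℝ E3 = 2 + 1) := ⟨by simp⟩
  rw [levelPlane, AffineSubspace.direction_mk']
  exact Submodule.finrank_orthogonal_span_singleton (by rintro rfl; simp at hn)

theorem mem_levelPlane {n : E3} (hn : ‖n‖ = 1) {τ : ℝ} {x : E3} :
    x ∈ levelPlane n τ ↔ inner ℝ x n = τ := by
  rw [levelPlane, AffineSubspace.mem_mk', Submodule.mem_orthogonal_singleton_iff_inner_right,
    vsub_eq_sub, inner_sub_right, inner_smul_right, real_inner_self_eq_norm_sq, hn,
    real_inner_comm]
  constructor <;> intro h <;> linarith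

/-- A tube whose axis is parallel to a plane and within one radius of it is tangential to it. -/
theorem isTangentialToPlane_levelPlane {δ R : ℝ} (hR : 0 < R) {T : Tube} {n : E3} (hn : ‖n‖ = 1)
    (hT : inner ℝ T.dir n = 0) {τ : ℝ} (h : |inner ℝ T.center n - τ| ≤ R ^ (1 / 2 + δ)) :
    IsTangentialToPlane δ R T (levelPlane n τ) := by
  constructor
  · have hmem : T.dir ∈ (levelPlane n τ).direction := by
      rw [levelPlane, AffineSubspace.direction_mk',
        Submodule.mem_orthogonal_singleton_iff_inner_right, real_inner_comm]
      exact hT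
    rw [subspaceAngle, Submodule.starProjection_eq_self_iff.2 hmem,
      InnerProductGeometry.angle_self (by intro h0; simpa [h0] using T.norm_dir)]
    positivity
  · rintro x ⟨-, hx⟩
    rw [one_mul] at hx
    set q := x - (inner ℝ x n - τ) • n with hq
    have hqm : q ∈ levelPlane n τ := by
      rw [mem_levelPlane hn, hq, inner_sub_left, inner_smul_left, real_inner_self_eq_norm_sq, hn]
      simp
    refine Metric.mem_cthickening_of_dist_le x q _ _ hqm ?_
    rw [dist_eq_norm, hq, sub_sub_cancel, norm_smul, hn, mul_one, Real.norm_eq_abs]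
    have e : inner ℝ x n - τ = inner ℝ (x - T.center - (inner ℝ (x - T.center) T.dir : ℝ) • T.dir) n
        + (inner ℝ T.center n - τ) := by
      rw [inner_sub_left, inner_sub_left, inner_smul_left, hT]
      ring
    rw [e]
    refine (abs_add_le _ _).trans ?_
    have h1 := abs_real_inner_le_norm
      (x - T.center - (inner ℝ (x - T.center) T.dir : ℝ) • T.dir) n
    rw [hn, mul_one] at h1
    linarith

open scoped Classical in
/-- The planes with normal `n` at the levels `τ + k ρ`, `|k| ≤ m`. -/
def planeGrid (n : E3) (τ ρ : ℝ) (m : ℕ) : Finset (AffineSubspace ℝ E3) :=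
  (Finset.Icc (-m : ℤ) m).image fun k : ℤ => levelPlane n (τ + k * ρ)

theorem card_planeGrid_le (n : E3) (τ ρ : ℝ) (m : ℕ) : (planeGrid n τ ρ m).card ≤ 2 * m + 1 := by
  classical
  refine Finset.card_image_le.trans ?_
  rw [Int.card_Icc]
  omega

theorem isPlane_of_mem_planeGrid {n : E3} (hn : ‖n‖ = 1) {τ ρ : ℝ} {m : ℕ}
    {H : AffineSubspace ℝ E3} (hH : H ∈ planeGrid n τ ρ m) : IsPlane H := by
  classical
  obtain ⟨k, -, rfl⟩ := Finset.mem_image.1 hH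
  exact isPlane_levelPlane hn _

/-- Rounding to the nearest integer multiple. -/
theorem exists_int_mul_near {ρ x : ℝ} (hρ : 0 < ρ) {m : ℕ} (hx : |x| ≤ m * ρ) :
    ∃ k ∈ Finset.Icc (-m : ℤ) m, |x - k * ρ| ≤ ρ / 2 := by
  have h1 : |x / ρ| ≤ m := by rw [abs_div, abs_of_pos hρ, div_le_iff₀ hρ]; exact hx
  have h2 := abs_sub_round (x / ρ)
  refine ⟨round (x / ρ), ?_, ?_⟩
  · rw [Finset.mem_Icc]
    have h3 := abs_le.1 h1
    have h4 := abs_le.1 h2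
    constructor
    · have : (-(m : ℤ) - 1 : ℤ) < round (x / ρ) := by
        have : ((-(m : ℤ) - 1 : ℤ) : ℝ) < round (x / ρ) := by push_cast; linarith
        exact_mod_cast this
      omega
    · have : round (x / ρ) < (m + 1 : ℤ) := by
        have : (round (x / ρ) : ℝ) < ((m + 1 : ℤ) : ℝ) := by push_cast; linarith
        exact_mod_cast this
      omega
  · have e : x - round (x / ρ) * ρ = (x / ρ - round (x / ρ)) * ρ := by field_simp
    rw [e, abs_mul, abs_of_pos hρ]
    nlinarith

theorem exists_mem_planeGrid {δ R : ℝ} (hR : 0 < R) {T : Tube} {n : E3} (hn : ‖n‖ = 1)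
    (hT : inner ℝ T.dir n = 0) {τ : ℝ} {m : ℕ}
    (h : |inner ℝ T.center n - τ| ≤ m * R ^ (1 / 2 + δ)) :
    ∃ H ∈ planeGrid n τ (R ^ (1 / 2 + δ)) m, IsTangentialToPlane δ R T H := by
  classical
  have hr : 0 < R ^ (1 / 2 + δ) := Real.rpow_pos_of_pos hR _
  obtain ⟨k, hk, hkx⟩ := exists_int_mul_near hr h
  refine ⟨_, Finset.mem_image_of_mem _ hk, isTangentialToPlane_levelPlane hR hn hT ?_⟩
  rw [← sub_sub]
  linarith

/-! ### Angles -/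

/-- A vector making a small angle with the plane orthogonal to `g` is almost orthogonal to `g`. -/
theorem abs_inner_le_of_subspaceAngle_le {u g : E3} {α : ℝ} (hu : ‖u‖ = 1)
    (h : subspaceAngle u (Submodule.span ℝ {g})ᗮ ≤ α) : |inner ℝ g u| ≤ α * ‖g‖ := by
  set W := (Submodule.span ℝ {g})ᗮ with hW
  set p := W.starProjection u with hp
  have hpW : p ∈ W := Submodule.starProjection_apply_mem W u
  have hup : inner ℝ (u - p) p = 0 :=
    Submodule.starProjection_inner_eq_zero u p hpW
  have hgp : inner ℝ g p = 0 := Submodule.mem_orthogonal_singleton_iff_inner_right.1 hpW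
  have hup' : inner ℝ u p = ‖p‖ ^ 2 := by
    rw [inner_sub_left, real_inner_self_eq_norm_sq] at hup
    linarith
  have hcos : Real.cos (subspaceAngle u W) = ‖p‖ := by
    rw [subspaceAngle, InnerProductGeometry.cos_angle, ← hp, hup', hu, one_mul]
    rcases eq_or_ne ‖p‖ 0 with h0 | h0
    · rw [h0]; simp
    · field_simp
  have hsin := Real.sin_sq_add_cos_sq (subspaceAngle u W)
  have hq : ‖u - p‖ ^ 2 + ‖p‖ ^ 2 = 1 := by
    rw [norm_sub_sq_real, hup', hu]; ring
  have hang : 0 ≤ subspaceAngle u W := InnerProductGeometry.angle_nonneg _ _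
  have hs : 0 ≤ Real.sin (subspaceAngle u W) :=
    Real.sin_nonneg_of_nonneg_of_le_pi hang (InnerProductGeometry.angle_le_pi _ _)
  have hqs : ‖u - p‖ = Real.sin (subspaceAngle u W) := by
    rw [hcos] at hsin
    exact (sq_eq_sq₀ (norm_nonneg _) hs).1 (by linarith)
  have hqα : ‖u - p‖ ≤ α := by rw [hqs]; exact (Real.sin_le hang).trans h
  have e : inner ℝ g u = inner ℝ g (u - p) := by rw [inner_sub_right, hgp, sub_zero]
  rw [e, mul_comm]
  exact (abs_real_inner_le_norm _ _).trans (by gcongr)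

/-- The component of `x` orthogonal to `u`. -/
def perpPart (u x : E3) : E3 := x - (inner ℝ x u : ℝ) • u

theorem perpPart_add (u x y : E3) : perpPart u (x + y) = perpPart u x + perpPart u y := by
  simp only [perpPart, inner_add_left]; module

theorem norm_perpPart_sq {u : E3} (hu : ‖u‖ = 1) (x : E3) :
    ‖perpPart u x‖ ^ 2 = ‖x‖ ^ 2 - inner ℝ x u ^ 2 := by
  rw [perpPart, norm_sub_sq_real, inner_smul_right, norm_smul, hu, mul_one, Real.norm_eq_abs, sq_abs]
  ring

theorem norm_perpPart_le {u : E3} (hu : ‖u‖ = 1) (x : E3) : ‖perpPart u x‖ ≤ ‖x‖ := by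
  refine abs_le_of_sq_le_sq' ?_ (norm_nonneg _) |>.2
  rw [norm_perpPart_sq hu]
  nlinarith [sq_nonneg (inner ℝ x u)]

theorem perpPart_smul_self {u : E3} (hu : ‖u‖ = 1) (t : ℝ) : perpPart u (t • u) = 0 := by
  rw [perpPart, inner_smul_left, real_inner_self_eq_norm_sq, hu]
  simp

/-- Unit vectors at angle at least `κ` differ by a component of size at least `2κ/π`. -/
theorem le_norm_perpPart_of_le_lineAngle {e e' : E3} (he : ‖e‖ = 1) (he' : ‖e'‖ = 1) {κ : ℝ}
    (hκ : 0 ≤ κ) (h : κ ≤ lineAngle e e') : 2 / Real.pi * κ ≤ ‖perpPart e e'‖ := by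
  set θ := InnerProductGeometry.angle e e' with hθ
  have h0 : 0 ≤ θ := InnerProductGeometry.angle_nonneg _ _
  have h1 : θ ≤ Real.pi := InnerProductGeometry.angle_le_pi _ _
  have hlin : lineAngle e e' = min θ (Real.pi - θ) := rfl
  have hsin : Real.sin (lineAngle e e') = Real.sin θ := by
    rw [hlin]
    rcases min_choice θ (Real.pi - θ) with hm | hm <;> rw [hm]
    exact Real.sin_pi_sub θ
  have hle : lineAngle e e' ≤ Real.pi / 2 := by
    rw [hlin]
    rcases le_total θ (Real.pi / 2) with h2 | h2
    · exact (min_le_left _ _).trans h2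
    · exact (min_le_right _ _).trans (by linarith)
  have hcos : inner ℝ e' e = Real.cos θ := by
    rw [hθ, InnerProductGeometry.cos_angle, he, he', real_inner_comm]
    simp
  have hsq : ‖perpPart e e'‖ ^ 2 = Real.sin θ ^ 2 := by
    rw [norm_perpPart_sq he, he', hcos, Real.sin_sq]; ring
  have hs : 0 ≤ Real.sin θ := Real.sin_nonneg_of_nonneg_of_le_pi h0 h1
  rw [(sq_eq_sq₀ (norm_nonneg _) hs).1 hsq, ← hsin]
  refine le_trans ?_ (Real.mul_le_sin (hκ.trans h) hle)
  have := Real.pi_pos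
  gcongr

/-! ### Covering one cell -/

/-- If every long enough sequence in `S` has a term related to a later one, then `S` is covered by
the relation classes of boundedly many of its elements. -/
theorem exists_finset_covering {X : Type*} (S : Set X) (rel : X → X → Prop) (M : ℕ)
    (h : ∀ N, M < N → ∀ f : Fin N → X, (∀ i, f i ∈ S) → ∃ i j, i < j ∧ rel (f i) (f j)) :
    ∃ F : Finset X, F.card ≤ M ∧ (∀ x ∈ F, x ∈ S) ∧ ∀ x ∈ S, ∃ y ∈ F, rel y x := by
  classical
  let good : ℕ → Prop := fun n =>
    ∃ f : Fin n → X, (∀ i, f i ∈ S) ∧ ∀ i j, i < j → ¬ rel (f i) (f j)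
  have hbound : ∀ n, good n → n ≤ M := by
    rintro n ⟨f, hf, hr⟩
    by_contra hn
    obtain ⟨i, j, hij, hrel⟩ := h n (by omega) f hf
    exact hr i j hij hrel
  have h0 : good 0 := ⟨Fin.elim0, fun i => i.elim0, fun i => i.elim0⟩
  obtain ⟨n, hnM, ⟨f, hf, hr⟩, hmax⟩ : ∃ n ≤ M, good n ∧ ¬ good (n + 1) := by
    refine ⟨Nat.findGreatest good M, Nat.findGreatest_le M,
      Nat.findGreatest_spec (P := good) (Nat.zero_le M) h0, fun hgood => ?_⟩
    have h1 := Nat.le_findGreatest (hbound _ hgood) hgood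
    omega
  refine ⟨Finset.univ.image f, ?_, ?_, ?_⟩
  · exact Finset.card_image_le.trans (by simpa using hnM)
  · intro x hx
    obtain ⟨i, -, rfl⟩ := Finset.mem_image.1 hx
    exact hf i
  · intro x hx
    by_contra hno
    push Not at hno
    refine hmax ⟨Fin.snoc (α := fun _ => X) f x, fun i => ?_, fun i j hij => ?_⟩
    · induction i using Fin.lastCases with
      | last => simpa using hx
      | cast i => simpa using hf i
    · induction j using Fin.lastCases with
      | last =>
        induction i using Fin.lastCases with
        | last => exact absurd hij (lt_irrefl _)
        | cast i =>
          simp only [Fin.snoc_castSucc, Fin.snoc_last]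
          exact hno _ (Finset.mem_image_of_mem _ (Finset.mem_univ i))
      | cast j =>
        induction i using Fin.lastCases with
        | last => exact absurd hij (not_lt.2 (Fin.le_last _))
        | cast i =>
          simp only [Fin.snoc_castSucc]
          exact hr i j (by simpa using hij)

/-- The condition `CrossTangent` relative to an orthonormal basis `b`: near `z` the surface `Z(P)`
is tangential to a tube in the direction `b 1` and to a tube in the direction `v`. -/
structure FrameCrossTangent (P : MvPolynomial (Fin 3) ℝ) (b : OrthonormalBasis (Fin 3) ℝ E3)
    (L α r s : ℝ) (z v : E3) : Prop where
  zero : polyEval P z = 0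
  dir_zero : inner ℝ (b 0) v = 1
  norm_dir_le : ‖v‖ ≤ 3 * L
  vertical : ∀ x, polyEval P x = 0 → |inner ℝ (b 0) (x - z)| ≤ 4 * r →
    |inner ℝ (b 2) (x - z)| ≤ 4 * r → |inner ℝ (b 1) (x - z)| ≤ 20 * L * s →
    |inner ℝ (polyGrad P x) (b 1)| ≤ α * ‖polyGrad P x‖
  along : ∀ x t, polyEval P x = 0 → |t| ≤ s → ‖x - z - t • v‖ ≤ 4 * r →
    |inner ℝ (polyGrad P x) v| ≤ 3 * L * α * ‖polyGrad P x‖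

section Frame

variable {P : MvPolynomial (Fin 3) ℝ} {b : OrthonormalBasis (Fin 3) ℝ E3} {d : ℕ} {L α r s : ℝ}

theorem FrameCrossTangent.crossTangent {z v : E3} (h : FrameCrossTangent P b L α r s z v) {o : E3}
    (ho : ∀ k, |inner ℝ (b k) (z - o)| ≤ s / 2) :
    CrossTangent (framePoly b o P) L α r s (b.repr (z - o)) (b.repr v) := by
  have hz : ∀ x', x' - b.repr (z - o) = b.repr (o + b.repr.symm x' - z) := by
    intro x'
    have e : o + b.repr.symm x' - z = b.repr.symm x' - (z - o) := by abel
    rw [e, map_sub b.repr (b.repr.symm x') (z - o), LinearIsometryEquiv.apply_symm_apply]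
  have hzk : ∀ x' k, x' k - b.repr (z - o) k = inner ℝ (b k) (o + b.repr.symm x' - z) := by
    intro x' k
    rw [← PiLp.sub_apply, hz, b.repr_apply_apply]
  refine ⟨?_, ?_, ?_, ?_, ?_, ?_⟩
  · rw [polyEval_framePoly, LinearIsometryEquiv.symm_apply_apply, add_sub_cancel]
    exact h.zero
  · intro k
    rw [b.repr_apply_apply]
    exact ho k
  · rw [b.repr_apply_apply]
    exact h.dir_zero
  · rw [LinearIsometryEquiv.norm_map]
    exact h.norm_dir_le
  · intro x hx h0 h2 h1
    rw [hzk] at h0 h1 h2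
    rw [polyEval_framePoly] at hx
    rw [polyGrad_framePoly, LinearIsometryEquiv.norm_map, b.repr_apply_apply, real_inner_comm]
    exact h.vertical _ hx h0 h2 h1
  · intro x t hx ht hn
    rw [hz, ← map_smul, ← map_sub, LinearIsometryEquiv.norm_map] at hn
    rw [polyEval_framePoly] at hx
    rw [polyGrad_framePoly, LinearIsometryEquiv.norm_map, LinearIsometryEquiv.inner_map_map]
    exact h.along _ t hx ht hn

/-- The tubes in the direction `b 1` that cross the surface, together with a transversal tube, at a
point of one cell, are covered by boundedly many planes. -/
theorem exists_planes_of_cell {δ R : ℝ} (hR : 0 < R) (hd : P.totalDegree ≤ d)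
    (hp : CellParameters d L α (R ^ (1 / 2 + δ)) s)
    (hsm : ∀ x, polyEval P x = 0 → polyGrad P x ≠ 0) (o : E3) :
    ∃ planes : Finset (AffineSubspace ℝ E3), (∀ H ∈ planes, IsPlane H) ∧
      planes.card ≤ cellPlaneBound d * 9 ∧
      ∀ (T : Tube) (z v : E3), T.dir = b 1 →
        FrameCrossTangent P b L α (R ^ (1 / 2 + δ)) s z v →
        (∀ k, |inner ℝ (b k) (z - o)| ≤ s / 2) →
        ‖perpPart T.dir (z - T.center)‖ ≤ 2 * R ^ (1 / 2 + δ) →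
        ∃ H ∈ planes, IsTangentialToPlane δ R T H := by
  classical
  set r := R ^ (1 / 2 + δ) with hr
  have hr0 : 0 < r := hp.pos_radius
  let S : Set (E3 × E3) := {p | FrameCrossTangent P b L α r s p.1 p.2 ∧
    ∀ k, |inner ℝ (b k) (p.1 - o)| ≤ s / 2}
  obtain ⟨F, hFc, hFS, hF⟩ := exists_finset_covering S
    (fun p q => |inner ℝ (b 2) (q.1 - p.1) - inner ℝ (b 0) (q.1 - p.1) * inner ℝ (b 2) p.2| ≤ 2 * r)
    (cellPlaneBound d) (by
      intro N hN f hf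
      obtain ⟨i, j, hij, h⟩ := exists_close_to_plane (totalDegree_framePoly_le b o hd) hp
        (by
          intro x hx h0
          rw [polyEval_framePoly] at hx
          rw [polyGrad_framePoly] at h0
          exact hsm _ hx (by simpa using h0)) hN
        (fun i => b.repr ((f i).1 - o)) (fun i => b.repr (f i).2)
        (fun i => (hf i).1.crossTangent (hf i).2)
      refine ⟨i, j, hij, ?_⟩
      simp only [b.repr_apply_apply] at h
      have e : ∀ k, inner ℝ (b k) ((f j).1 - (f i).1)
          = inner ℝ (b k) ((f j).1 - o) - inner ℝ (b k) ((f i).1 - o) := by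
        intro k
        rw [← inner_sub_right]
        congr 1
        abel
      rw [e, e]
      exact h)
  have hb : ∀ i j, inner ℝ (b i) (b j) = if i = j then (1 : ℝ) else 0 := fun i j =>
    orthonormal_iff_ite.1 b.orthonormal i j
  let normal : E3 × E3 → E3 := fun p => b 2 - (inner ℝ (b 2) p.2 : ℝ) • b 0
  have hN1 : ∀ p, 1 ≤ ‖normal p‖ := by
    intro p
    have h1 : inner ℝ (normal p) (b 2) = 1 := by
      simp [normal, inner_sub_left, inner_smul_left, hb]
    have h2 := abs_real_inner_le_norm (normal p) (b 2)
    rwa [h1, abs_one, b.norm_eq_one, mul_one] at h2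
  have hN0 : ∀ p, inner ℝ (b 1) (normal p) = 0 := by
    intro p
    simp [normal, inner_sub_right, inner_smul_right, hb]
  let unit : E3 × E3 → E3 := fun p => ‖normal p‖⁻¹ • normal p
  have hu1 : ∀ p, ‖unit p‖ = 1 := by
    intro p
    have := hN1 p
    simp only [unit, norm_smul, norm_inv, norm_norm]
    exact inv_mul_cancel₀ (by linarith)
  have hu0 : ∀ p, inner ℝ (b 1) (unit p) = 0 := by
    intro p
    simp [unit, inner_smul_right, hN0]
  have hle : ∀ p x, |inner ℝ x (unit p)| ≤ |inner ℝ x (normal p)| := by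
    intro p x
    simp only [unit, inner_smul_right, abs_mul, abs_inv, abs_norm]
    have h1 : ‖normal p‖⁻¹ ≤ 1 := inv_le_one_of_one_le₀ (hN1 p)
    nlinarith [abs_nonneg (inner ℝ x (normal p))]
  refine ⟨F.biUnion fun p => planeGrid (unit p) (inner ℝ p.1 (unit p)) r 4, ?_, ?_, ?_⟩
  · intro H hH
    obtain ⟨p, -, hp⟩ := Finset.mem_biUnion.1 hH
    exact isPlane_of_mem_planeGrid (hu1 p) hp
  · refine (Finset.card_biUnion_le_card_mul _ _ 9 fun p _ => card_planeGrid_le _ _ _ _).trans ?_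
    exact Nat.mul_le_mul_right _ hFc
  · intro T z v hT hz hzo hperp
    obtain ⟨p, hpF, hrel⟩ := hF (z, v) ⟨hz, hzo⟩
    simp only at hrel
    obtain ⟨H, hH, hHT⟩ := exists_mem_planeGrid (δ := δ) hR (T := T) (hu1 p) (by rw [hT]; exact hu0 p)
      (τ := inner ℝ p.1 (unit p)) (m := 4) (by
        have h1 : |inner ℝ (z - p.1) (unit p)| ≤ 2 * r := by
          refine (hle _ _).trans (le_trans (le_of_eq ?_) hrel)
          congr 1
          simp only [normal, inner_sub_right, inner_smul_right,
            real_inner_comm (b 2), real_inner_comm (b 0)]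
          ring
        have h2 : |inner ℝ (z - T.center) (unit p)| ≤ 2 * r := by
          have e : inner ℝ (z - T.center) (unit p)
              = inner ℝ (perpPart T.dir (z - T.center)) (unit p) := by
            rw [perpPart, inner_sub_left (z - T.center), inner_smul_left, hT, hu0]
            simp
          rw [e]
          refine (abs_real_inner_le_norm _ _).trans ?_
          rw [hu1, mul_one]
          exact hperp
        have e : inner ℝ T.center (unit p) - inner ℝ p.1 (unit p)
            = inner ℝ (z - p.1) (unit p) - inner ℝ (z - T.center) (unit p) := by
          rw [inner_sub_left, inner_sub_left]; ring
        rw [e]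
        refine (abs_sub _ _).trans ?_
        push_cast
        rw [← hr]
        linarith)
    exact ⟨H, Finset.mem_biUnion.2 ⟨p, hpF, hH⟩, hHT⟩

end Frame

/-! ### Tangential tubes in the essential sense -/

theorem isClosed_zeroSurface (P : MvPolynomial (Fin 3) ℝ) : IsClosed (zeroSurface P) :=
  isClosed_eq (continuous_polyEval P) continuous_const

/-- A tangential tube is tangential at the points of the surface that are near one of the points
of the tube in the ball. -/
theorem IsTangentialTube.abs_inner_polyGrad_le {P : MvPolynomial (Fin 3) ℝ} {δ R : ℝ} {a : E3}
    {T : Tube} (hT : IsTangentialTube P δ R a T) (hsm : IsSmoothSurface P) {x₀ z x : E3}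
    (h₀ : x₀ ∈ T.carrier δ R) (ha : ‖x₀ - a‖ ≤ R) (hz : ‖x₀ - z‖ ≤ R ^ (1 / 2 + δ))
    (hrR : R ^ (1 / 2 + δ) ≤ R / 2) (hx : x ∈ zeroSurface P) (hxz : ‖x - z‖ ≤ R / 2)
    (hperp : ‖perpPart T.dir (x - z)‖ ≤ 8 * R ^ (1 / 2 + δ)) :
    |inner ℝ (polyGrad P x) T.dir| ≤ R ^ (-1 / 2 + 2 * δ) * ‖polyGrad P x‖ := by
  obtain ⟨h1, h2⟩ := h₀
  rw [norm_sub_rev] at hz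
  have hxx : ‖x - x₀‖ ≤ R := by
    have e : x - x₀ = (x - z) + (z - x₀) := by abel
    rw [e]
    exact (norm_add_le _ _).trans (by linarith)
  refine abs_inner_le_of_subspaceAngle_le T.norm_dir (hT.2 x (hsm x hx) ⟨?_, ?_⟩ ?_)
  · have e : x - T.center = (x - x₀) + (x₀ - T.center) := by abel
    rw [e, inner_add_left]
    have h3 := abs_real_inner_le_norm (x - x₀) T.dir
    rw [T.norm_dir, mul_one] at h3
    refine (abs_add_le _ _).trans ?_
    linarith [norm_nonneg (x - x₀)]
  · change ‖perpPart T.dir (x - T.center)‖ ≤ _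
    have e : x - T.center = (x - z) + ((z - x₀) + (x₀ - T.center)) := by abel
    have h3 := (norm_perpPart_le T.norm_dir (z - x₀)).trans hz
    have h4 : ‖perpPart T.dir (x₀ - T.center)‖ ≤ 1 * R ^ (1 / 2 + δ) := h2
    rw [e, perpPart_add, perpPart_add]
    refine (norm_add_le _ _).trans ?_
    have h5 := norm_add_le (perpPart T.dir (z - x₀)) (perpPart T.dir (x₀ - T.center))
    linarith
  · rw [Metric.mem_closedBall, dist_eq_norm]
    have e : x - a = (x - x₀) + (x₀ - a) := by abel
    rw [e]
    exact (norm_add_le _ _).trans (by linarith)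

theorem norm_le_sum_abs_inner (b : OrthonormalBasis (Fin 3) ℝ E3) (x : E3) :
    ‖x‖ ≤ |inner ℝ (b 0) x| + |inner ℝ (b 1) x| + |inner ℝ (b 2) x| := by
  rw [← b.repr.norm_map x, ← b.repr_apply_apply, ← b.repr_apply_apply, ← b.repr_apply_apply]
  exact norm_le_sum_abs_coord _

theorem norm_sq_perpPart_basis (b : OrthonormalBasis (Fin 3) ℝ E3) (x : E3) :
    ‖perpPart (b 1) x‖ ^ 2 = inner ℝ (b 0) x ^ 2 + inner ℝ (b 2) x ^ 2 := by
  rw [norm_perpPart_sq (b.norm_eq_one 1), ← b.repr.norm_map x, norm_sq_eq_coord,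
    real_inner_comm, b.repr_apply_apply, b.repr_apply_apply, b.repr_apply_apply]
  ring

theorem norm_perpPart_basis_le (b : OrthonormalBasis (Fin 3) ℝ E3) (x : E3) :
    ‖perpPart (b 1) x‖ ≤ |inner ℝ (b 0) x| + |inner ℝ (b 2) x| := by
  refine abs_le_of_sq_le_sq' ?_ (by positivity) |>.2
  rw [norm_sq_perpPart_basis, ← sq_abs (inner ℝ (b 0) x), ← sq_abs (inner ℝ (b 2) x)]
  nlinarith [abs_nonneg (inner ℝ (b 0) x), abs_nonneg (inner ℝ (b 2) x),
    mul_nonneg (abs_nonneg (inner ℝ (b 0) x)) (abs_nonneg (inner ℝ (b 2) x))]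

/-- Two tangential tubes through a common point of the fat surface, transversal in the sense that
the second one has a component along `b 0`, make the surface tangential to both directions near
a point of the surface. -/
theorem frameCrossTangent_of_isTangentialTube {P : MvPolynomial (Fin 3) ℝ} {δ R L s : ℝ}
    {a : E3} {T T' : Tube} (hT : IsTangentialTube P δ R a T) (hT' : IsTangentialTube P δ R a T')
    (hsm : IsSmoothSurface P) {b : OrthonormalBasis (Fin 3) ℝ E3} (hb : b 1 = T.dir)
    {x₀ z : E3} (h₀ : x₀ ∈ T.carrier δ R) (h₀' : x₀ ∈ T'.carrier δ R) (ha : ‖x₀ - a‖ ≤ R)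
    (hzP : z ∈ zeroSurface P) (hz : ‖x₀ - z‖ ≤ R ^ (1 / 2 + δ)) (hR : 0 < R) (hL : 0 < L)
    (hs : 0 ≤ s) (hsR : 20 * L * s + 8 * R ^ (1 / 2 + δ) ≤ R / 2)
    (hdir : 1 ≤ 3 * L * |inner ℝ (b 0) T'.dir|) :
    FrameCrossTangent P b L (R ^ (-1 / 2 + 2 * δ)) (R ^ (1 / 2 + δ)) s z
      ((inner ℝ (b 0) T'.dir : ℝ)⁻¹ • T'.dir) := by
  set r := R ^ (1 / 2 + δ) with hr
  set c : ℝ := inner ℝ (b 0) T'.dir with hc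
  have hr0 : 0 < r := Real.rpow_pos_of_pos hR _
  have hLs : 0 ≤ L * s := by positivity
  have hc0 : c ≠ 0 := by
    intro h
    rw [h] at hdir
    norm_num at hdir
  have hcinv : |c⁻¹| ≤ 3 * L := by
    rw [abs_inv, inv_le_iff_one_le_mul₀ (abs_pos.2 hc0)]
    exact hdir
  have hv : ‖c⁻¹ • T'.dir‖ ≤ 3 * L := by
    rw [norm_smul, T'.norm_dir, mul_one]
    exact hcinv
  refine ⟨hzP, ?_, hv, ?_, ?_⟩
  · rw [inner_smul_right, ← hc, inv_mul_cancel₀ hc0]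
  · intro x hx h0 h2 h1
    rw [hb]
    refine hT.abs_inner_polyGrad_le hsm h₀ ha hz (by linarith) hx ?_ ?_
    · exact (norm_le_sum_abs_inner b _).trans (by linarith)
    · rw [← hb]
      exact (norm_perpPart_basis_le b _).trans (by linarith)
  · intro x t hx ht hn
    have e : x - z = (x - z - t • c⁻¹ • T'.dir) + (t * c⁻¹) • T'.dir := by module
    have htc : ‖(t * c⁻¹) • T'.dir‖ ≤ s * (3 * L) := by
      rw [norm_smul, T'.norm_dir, mul_one, Real.norm_eq_abs, abs_mul]
      gcongr
    have h := hT'.abs_inner_polyGrad_le (z := z) hsm h₀' ha hz (by linarith) hx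
      (by
        rw [e]
        refine (norm_add_le _ _).trans ?_
        linarith)
      (by
        rw [e, perpPart_add, perpPart_smul_self T'.norm_dir, add_zero]
        refine (norm_perpPart_le T'.norm_dir _).trans ?_
        linarith)
    rw [inner_smul_right, abs_mul, mul_assoc]
    gcongr

/-- A tube that is tangential in the essential sense passes near a point of the surface at which
the surface is tangential to a second direction, transversal to `b 0` or to `b 2`. -/
theorem IsEssTangentialTube.exists_frameCrossTangent {P : MvPolynomial (Fin 3) ℝ} {δ R K L s : ℝ}
    {a : E3} {T : Tube} (hT : IsEssTangentialTube P δ R K a T) (hsm : IsSmoothSurface P)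
    {b : OrthonormalBasis (Fin 3) ℝ E3} (hb : b 1 = T.dir) (hR : 0 < R) (hK : 0 < K)
    (hKL : K ≤ L) (hs : 0 ≤ s) (hsR : 20 * L * s + 8 * R ^ (1 / 2 + δ) ≤ R / 2) :
    ∃ z v, ‖perpPart T.dir (z - T.center)‖ ≤ 2 * R ^ (1 / 2 + δ) ∧ ‖z - a‖ ≤ 2 * R ∧
      ∃ b' ∈ ({b, b.reindex (Equiv.swap 0 2)} : Set (OrthonormalBasis (Fin 3) ℝ E3)),
        FrameCrossTangent P b' L (R ^ (-1 / 2 + 2 * δ)) (R ^ (1 / 2 + δ)) s z v := by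
  obtain ⟨hT, T', hT', ⟨x₀, ⟨h₀, h₀'⟩, hx₀, hxa⟩, hang⟩ := hT
  have hL : 0 < L := hK.trans_le hKL
  have hr0 : 0 < R ^ (1 / 2 + δ) := Real.rpow_pos_of_pos hR _
  have hLs : 0 ≤ L * s := by positivity
  rw [(isClosed_zeroSurface P).cthickening_eq_biUnion_closedBall hr0.le] at hx₀
  obtain ⟨z, hzP, hz⟩ := Set.mem_iUnion₂.1 hx₀
  rw [Metric.mem_closedBall, dist_eq_norm] at hz hxa
  have hz' := hz
  rw [norm_sub_rev] at hz'
  have hperp : ‖perpPart T.dir (z - T.center)‖ ≤ 2 * R ^ (1 / 2 + δ) := by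
    have e : z - T.center = (z - x₀) + (x₀ - T.center) := by abel
    have h1 := (norm_perpPart_le T.norm_dir (z - x₀)).trans hz'
    have h2 : ‖perpPart T.dir (x₀ - T.center)‖ ≤ 1 * R ^ (1 / 2 + δ) := h₀.2
    rw [e, perpPart_add]
    refine (norm_add_le _ _).trans ?_
    linarith
  have hza : ‖z - a‖ ≤ 2 * R := by
    have e : z - a = (z - x₀) + (x₀ - a) := by abel
    rw [e]
    refine (norm_add_le _ _).trans ?_
    linarith
  have hsin := le_norm_perpPart_of_le_lineAngle T.norm_dir T'.norm_dir (inv_pos.2 hK).le hang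
  have hbig : (3 / 5) * L⁻¹ ≤ ‖perpPart T.dir T'.dir‖ := by
    refine le_trans ?_ hsin
    have h1 : (3 / 5 : ℝ) ≤ 2 / Real.pi := by
      rw [le_div_iff₀ Real.pi_pos]
      linarith [Real.pi_lt_d2]
    gcongr
  have hsq := norm_sq_perpPart_basis b T'.dir
  rw [hb] at hsq
  -- `perpPart` has two components, and `2 (1/3)² < (3/5)²`
  have hor : 1 ≤ 3 * L * |inner ℝ (b 0) T'.dir| ∨ 1 ≤ 3 * L * |inner ℝ (b 2) T'.dir| := by
    by_contra! hno
    obtain ⟨h0, h2⟩ := hno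
    have hb1 : 3 / 5 ≤ L * ‖perpPart T.dir T'.dir‖ := by
      calc (3 / 5 : ℝ) = L * (3 / 5 * L⁻¹) := by field_simp
        _ ≤ _ := by gcongr
    have h0' := pow_lt_pow_left₀ h0 (by positivity) two_ne_zero
    have h2' := pow_lt_pow_left₀ h2 (by positivity) two_ne_zero
    have hb2 := pow_le_pow_left₀ (by norm_num) hb1 2
    rw [mul_pow, hsq] at hb2
    rw [mul_pow, sq_abs] at h0' h2'
    nlinarith
  rcases hor with h | h
  · exact ⟨z, _, hperp, hza, b, by simp,
      frameCrossTangent_of_isTangentialTube hT hT' hsm hb h₀ h₀' hxa hzP hz hR hL hs hsR h⟩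
  · refine ⟨z, _, hperp, hza, b.reindex (Equiv.swap 0 2), by simp,
      frameCrossTangent_of_isTangentialTube hT hT' hsm ?_ h₀ h₀' hxa hzP hz hR hL hs hsR ?_⟩
    · rw [OrthonormalBasis.reindex_apply, ← hb]
      rfl
    · rw [OrthonormalBasis.reindex_apply]
      exact h

/-- The tubes of `exists_planes_of_cell` in all the cells of a ball. -/
theorem exists_planes_of_frame {P : MvPolynomial (Fin 3) ℝ} {b : OrthonormalBasis (Fin 3) ℝ E3}
    {d : ℕ} {L α δ R s : ℝ} (hR : 0 < R) (hd : P.totalDegree ≤ d)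
    (hp : CellParameters d L α (R ^ (1 / 2 + δ)) s)
    (hsm : ∀ x, polyEval P x = 0 → polyGrad P x ≠ 0) (a : E3) {n : ℕ} {ρ : ℝ} (hn : ρ ≤ n * s) :
    ∃ planes : Finset (AffineSubspace ℝ E3), (∀ H ∈ planes, IsPlane H) ∧
      planes.card ≤ (2 * n + 1) ^ 3 * (cellPlaneBound d * 9) ∧
      ∀ (T : Tube) (z v : E3), T.dir = b 1 →
        FrameCrossTangent P b L α (R ^ (1 / 2 + δ)) s z v → ‖z - a‖ ≤ ρ →
        ‖perpPart T.dir (z - T.center)‖ ≤ 2 * R ^ (1 / 2 + δ) →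
        ∃ H ∈ planes, IsTangentialToPlane δ R T H := by
  classical
  choose F hF hFc hFT using exists_planes_of_cell (b := b) hR hd hp hsm
  let center : (Fin 3 → ℤ) → E3 := fun k => a + b.repr.symm (WithLp.toLp 2 fun i => (k i : ℝ) * s)
  let cells : Finset (Fin 3 → ℤ) := Fintype.piFinset fun _ => Finset.Icc (-n : ℤ) n
  refine ⟨cells.biUnion fun k => F (center k), ?_, ?_, ?_⟩
  · intro H hH
    obtain ⟨k, -, hk⟩ := Finset.mem_biUnion.1 hH
    exact hF _ _ hk
  · refine (Finset.card_biUnion_le_card_mul _ _ _ fun k _ => hFc (center k)).trans ?_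
    refine Nat.mul_le_mul_right _ (le_of_eq ?_)
    rw [Fintype.card_piFinset_const, Int.card_Icc]
    congr 1
    omega
  · intro T z v hT hz hza hperp
    have hcoord : ∀ i, ∃ k ∈ Finset.Icc (-n : ℤ) n, |inner ℝ (b i) (z - a) - k * s| ≤ s / 2 := by
      intro i
      refine exists_int_mul_near hp.pos_side (le_trans ?_ (hza.trans hn))
      have h := abs_real_inner_le_norm (b i) (z - a)
      rwa [b.norm_eq_one, one_mul] at h
    choose k hk hks using hcoord
    obtain ⟨H, hH, hHT⟩ := hFT (center k) T z v hT hz (fun i => by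
      have e : z - center k = (z - a) - b.repr.symm (WithLp.toLp 2 fun i => (k i : ℝ) * s) := by
        simp only [center]; abel
      rw [e, inner_sub_right, ← b.repr_apply_apply _ i, ← b.repr_apply_apply _ i,
        LinearIsometryEquiv.apply_symm_apply, b.repr_apply_apply]
      exact hks i) hperp
    exact ⟨H, Finset.mem_biUnion.2 ⟨k, Fintype.mem_piFinset.2 hk, hH⟩, hHT⟩

theorem exists_orthonormalBasis_eq {e : E3} (he : ‖e‖ = 1) :
    ∃ b : OrthonormalBasis (Fin 3) ℝ E3, b 1 = e := by
  have ho : Orthonormal ℝ (({1} : Set (Fin 3)).domRestrict fun _ : Fin 3 => e) := by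
    refine ⟨fun _ => he, fun i j hij => ?_⟩
    exact absurd (Subsingleton.elim i j) hij
  obtain ⟨b, hb⟩ := ho.exists_orthonormalBasis_extension_of_card_eq (by simp)
  exact ⟨b, hb 1 rfl⟩

/-- The tubes in a direction orthogonal to `n` that meet a ball are covered by planes with normal
`n`, as many as the ratio of the radii. -/
theorem exists_planeGrid_of_meets_ball {δ R : ℝ} (hR : 0 < R) {n a : E3} (hn : ‖n‖ = 1) {m : ℕ}
    (hm : R + R ^ (1 / 2 + δ) ≤ m * R ^ (1 / 2 + δ)) {T : Tube} (hT : inner ℝ T.dir n = 0)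
    {x : E3} (hx : x ∈ T.carrier δ R) (hxa : ‖x - a‖ ≤ R) :
    ∃ H ∈ planeGrid n (inner ℝ a n) (R ^ (1 / 2 + δ)) m, IsTangentialToPlane δ R T H := by
  refine exists_mem_planeGrid hR hn hT (le_trans ?_ hm)
  have e : inner ℝ T.center n - inner ℝ a n
      = inner ℝ (x - a) n - inner ℝ (perpPart T.dir (x - T.center)) n := by
    rw [perpPart, inner_sub_left (x - T.center), inner_smul_left, hT, inner_sub_left,
      inner_sub_left]
    ring
  have h1 := abs_real_inner_le_norm (x - a) n
  have h2 := abs_real_inner_le_norm (perpPart T.dir (x - T.center)) n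
  have h3 : ‖perpPart T.dir (x - T.center)‖ ≤ 1 * R ^ (1 / 2 + δ) := hx.2
  rw [hn, mul_one] at h1 h2
  rw [e]
  exact (abs_sub _ _).trans (by linarith)

/-! ### Choice of parameters -/

/-- The constant `C₀` such that the cells have side `R / (C₀ L⁵)`, where `L = R ^ δ`. -/
def cellRatio (d : ℕ) : ℝ := 2000 * (d + 1)

theorem le_cellRatio (d : ℕ) : 2000 ≤ cellRatio d := by
  have : (0 : ℝ) ≤ d := d.cast_nonneg
  unfold cellRatio
  linarith

/-- The radius of the tubes and the tangency angle in terms of `L = R ^ δ`. -/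
theorem rpow_radius_angle {δ R : ℝ} (hR : 0 < R) :
    R ^ (1 / 2 + δ) = R ^ (1 / 2 : ℝ) * R ^ δ ∧
      R ^ (-1 / 2 + 2 * δ) * R ^ (1 / 2 : ℝ) = (R ^ δ) ^ 2 := by
  constructor
  · exact Real.rpow_add hR _ _
  · rw [← Real.rpow_add hR, ← Real.rpow_natCast, ← Real.rpow_mul hR.le]
    congr 1
    push_cast
    ring

theorem rpow_half_mul_self {R : ℝ} (hR : 0 < R) : R ^ (1 / 2 : ℝ) * R ^ (1 / 2 : ℝ) = R := by
  rw [← Real.rpow_add hR]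
  norm_num

section Parameters

variable {d : ℕ} {δ R : ℝ}

theorem cellParameters_of_le (hR : 1 ≤ R) (hδ : 0 < δ)
    (h : cellRatio d * (R ^ δ) ^ 5 ≤ R ^ (1 / 2 : ℝ)) :
    CellParameters d (R ^ δ) (R ^ (-1 / 2 + 2 * δ)) (R ^ (1 / 2 + δ))
      (R / (cellRatio d * (R ^ δ) ^ 5)) := by
  have hR0 : 0 < R := by linarith
  have hC := le_cellRatio d
  have hC0 : 0 < cellRatio d := by linarith
  have hL : 1 ≤ R ^ δ := Real.one_le_rpow hR hδ.le
  obtain ⟨hr, hα⟩ := rpow_radius_angle (δ := δ) hR0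
  have hα0 : 0 < R ^ (-1 / 2 + 2 * δ) := Real.rpow_pos_of_pos hR0 _
  have hr0 : 0 < R ^ (1 / 2 + δ) := Real.rpow_pos_of_pos hR0 _
  have hq0 : 0 < R ^ (1 / 2 : ℝ) := Real.rpow_pos_of_pos hR0 _
  have hq := rpow_half_mul_self hR0
  set L := R ^ δ
  set α := R ^ (-1 / 2 + 2 * δ)
  set q := R ^ (1 / 2 : ℝ)
  have hL0 : 0 < L := by linarith
  refine ⟨hL, hα0, hr0, by positivity, ?_, ?_, ?_⟩
  · have h1 : 100 * L * α * q ≤ 1 * q := by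
      calc 100 * L * α * q = 100 * L ^ 3 := by rw [mul_assoc _ α q, hα]; ring
        _ ≤ cellRatio d * L ^ 5 := by
          have : L ^ 3 ≤ L ^ 5 := pow_le_pow_right₀ hL (by norm_num)
          have : 0 < L ^ 3 := by positivity
          nlinarith
        _ ≤ 1 * q := by linarith
    exact le_of_mul_le_mul_right h1 hq0
  · rw [hr, mul_div_assoc', le_div_iff₀ (by positivity)]
    calc q * L * (cellRatio d * L ^ 5) ≤ q * L * q := by gcongr
      _ = L * R := by rw [← hq]; ring
  · have e : 2000 * ((d : ℝ) + 1) * L ^ 4 * α * (R / (cellRatio d * L ^ 5)) = α * R / L := by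
      have : 2000 * ((d : ℝ) + 1) = cellRatio d := rfl
      rw [this]
      field_simp
    rw [e, hr, div_le_iff₀ hL0]
    calc α * R = α * q * q := by rw [mul_assoc, hq]
      _ = L ^ 2 * q := by rw [hα]
      _ ≤ q * L * L := by ring_nf; exact le_rfl

theorem cell_size_le (hR : 1 ≤ R) (hδ : 0 < δ)
    (h : cellRatio d * (R ^ δ) ^ 5 ≤ R ^ (1 / 2 : ℝ)) :
    20 * R ^ δ * (R / (cellRatio d * (R ^ δ) ^ 5)) + 8 * R ^ (1 / 2 + δ) ≤ R / 2 := by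
  have hR0 : 0 < R := by linarith
  have hC := le_cellRatio d
  have hC0 : 0 < cellRatio d := by linarith
  have hL : 1 ≤ R ^ δ := Real.one_le_rpow hR hδ.le
  have hr := (cellParameters_of_le hR hδ h).radius_le
  set L := R ^ δ
  have hL0 : 0 < L := by linarith
  have h1 : L * (R / (cellRatio d * L ^ 5)) ≤ R / 2000 := by
    rw [mul_div_assoc', div_le_div_iff₀ (by positivity) (by norm_num)]
    calc L * R * 2000 = R * (2000 * L ^ 1) := by ring
      _ ≤ R * (cellRatio d * L ^ 5) := by
        gcongr
        norm_num
  linarith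

/-- In the main case `R` is large and `δ` is small, so `K ≤ L`. -/
theorem rpow_sq_le (hR : 1 ≤ R) (hδ : 0 < δ)
    (h : cellRatio d * (R ^ δ) ^ 5 ≤ R ^ (1 / 2 : ℝ)) : R ^ (δ ^ 2) ≤ R ^ δ := by
  have hR0 : 0 < R := by linarith
  have hC := le_cellRatio d
  have hL : 1 ≤ R ^ δ := Real.one_le_rpow hR hδ.le
  have h5 : (1 : ℝ) ≤ (R ^ δ) ^ 5 := one_le_pow₀ hL
  rcases le_or_gt δ 1 with hδ1 | hδ1
  · exact Real.rpow_le_rpow_of_exponent_le hR (by nlinarith)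
  · exfalso
    have h1 : R ^ (1 / 2 : ℝ) ≤ R ^ δ := Real.rpow_le_rpow_of_exponent_le hR (by linarith)
    have h2 : R ^ δ ≤ (R ^ δ) ^ 5 := le_self_pow₀ hL (by norm_num)
    nlinarith

theorem card_frame_cells_le {X : ℝ} (hX : 1 ≤ X) : ((2 * ⌈2 * X⌉₊ + 1 : ℕ) : ℝ) ≤ 7 * X := by
  have := Nat.ceil_lt_add_one (show 0 ≤ 2 * X by linarith)
  push_cast
  linarith

end Parameters

/-! ### Covering the ball -/

theorem lemma5p3 :
    ∃ A : ℝ, ∀ d : ℕ, ∃ C : ℝ, ∀ δ : ℝ, 0 < δ → ∀ R : ℝ, 1 ≤ R →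
      ∀ (a : E3) (P : MvPolynomial (Fin 3) ℝ), P.totalDegree ≤ d → IsSmoothSurface P →
      ∀ e : E3, ‖e‖ = 1 →
        ∃ planes : Finset (AffineSubspace ℝ E3),
          (∀ H ∈ planes, IsPlane H) ∧
          (planes.card : ℝ) ≤ C * R ^ (A * δ) ∧
          ∀ T : Tube, T.dir = e → IsEssTangentialTube P δ R (R ^ (δ ^ 2)) a T →
            ∃ H ∈ planes, IsTangentialToPlane δ R T H := by
  classical
  -- the number of cells is of order `(L ^ 5) ^ 3`
  refine ⟨15, fun d =>
    ⟨7 * cellRatio d + 2 * ((7 * cellRatio d) ^ 3 * (cellPlaneBound d * 9)), ?_⟩⟩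
  intro δ hδ R hR a P hd hsm e he
  have hR0 : 0 < R := by linarith
  have hC := le_cellRatio d
  have hL : 1 ≤ R ^ δ := Real.one_le_rpow hR hδ.le
  have h15 : R ^ (15 * δ) = (R ^ δ) ^ 15 := by
    rw [← Real.rpow_natCast, ← Real.rpow_mul hR0.le, mul_comm]
    norm_num
  rw [h15]
  have h5 : 1 ≤ (R ^ δ) ^ 5 := one_le_pow₀ hL
  have hX : 1 ≤ cellRatio d * (R ^ δ) ^ 5 := by nlinarith
  obtain ⟨b, hb⟩ := exists_orthonormalBasis_eq he
  rcases le_or_gt (cellRatio d * (R ^ δ) ^ 5) (R ^ (1 / 2 : ℝ)) with h | h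
  -- the main case: the surface is considered in two frames for each cell, according to the direction
  -- `b 0` or `b 2` to which the second tube is transversal
  · have hp := cellParameters_of_le hR hδ h
    have hsz := cell_size_le hR hδ h
    have hK := rpow_sq_le hR hδ h
    set X := cellRatio d * (R ^ δ) ^ 5 with hXdef
    have hn : 2 * R ≤ (⌈2 * X⌉₊ : ℕ) * (R / X) := by
      calc 2 * R = (2 * X) * (R / X) := by field_simp
        _ ≤ _ := by
          gcongr
          exact Nat.le_ceil _
    have hns : ∀ x, polyEval P x = 0 → polyGrad P x ≠ 0 := fun x hx => (hsm x hx).2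
    choose F hF hFc hFT using fun b : OrthonormalBasis (Fin 3) ℝ E3 =>
      exists_planes_of_frame (b := b) hR0 hd hp hns a hn
    refine ⟨F b ∪ F (b.reindex (Equiv.swap 0 2)), ?_, ?_, ?_⟩
    · intro H hH
      rcases Finset.mem_union.1 hH with hH | hH
      · exact hF _ H hH
      · exact hF _ H hH
    · have hcard : ∀ b', ((F b').card : ℝ) ≤ (7 * X) ^ 3 * (cellPlaneBound d * 9) := by
        intro b'
        calc ((F b').card : ℝ)
            ≤ ((2 * ⌈2 * X⌉₊ + 1 : ℕ) : ℝ) ^ 3 * (cellPlaneBound d * 9) := by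
              exact_mod_cast hFc b'
          _ ≤ _ := by
              gcongr
              exact card_frame_cells_le hX
      have hu : ((F b ∪ F (b.reindex (Equiv.swap 0 2))).card : ℝ)
          ≤ (F b).card + (F (b.reindex (Equiv.swap 0 2))).card := by
        exact_mod_cast Finset.card_union_le _ _
      calc _ ≤ _ := hu
        _ ≤ 2 * ((7 * X) ^ 3 * (cellPlaneBound d * 9)) := by
          linarith [hcard b, hcard (b.reindex (Equiv.swap 0 2))]
        _ = 2 * ((7 * cellRatio d) ^ 3 * (cellPlaneBound d * 9)) * (R ^ δ) ^ 15 := by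
          rw [hXdef]; ring
        _ ≤ _ := by
          gcongr
          linarith
    · intro T hT hTe
      obtain ⟨z, v, hperp, hza, b', hb', hf⟩ := hTe.exists_frameCrossTangent hsm
        (hb.trans hT.symm) hR0 (Real.rpow_pos_of_pos hR0 _) hK hp.pos_side.le hsz
      rcases hb' with rfl | rfl
      · obtain ⟨H, hH, hHT⟩ := hFT _ T z v (hT.trans hb.symm) hf hza hperp
        exact ⟨H, Finset.mem_union_left _ hH, hHT⟩
      · obtain ⟨H, hH, hHT⟩ := hFT _ T z v
          (by rw [OrthonormalBasis.reindex_apply, hT, ← hb]; rfl) hf hza hperp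
        exact ⟨H, Finset.mem_union_right _ hH, hHT⟩
  -- here `R ≤ X r`, so parallel planes at distance `r` suffice
  · set X := cellRatio d * (R ^ δ) ^ 5 with hXdef
    have h01 : inner ℝ (b 1) (b 0) = 0 := b.orthonormal.2 (by decide)
    have hm : R + R ^ (1 / 2 + δ) ≤ (⌈2 * X⌉₊ : ℕ) * R ^ (1 / 2 + δ) := by
      have hr : R ^ (1 / 2 : ℝ) ≤ R ^ (1 / 2 + δ) :=
        Real.rpow_le_rpow_of_exponent_le hR (by linarith)
      have hr0 : 0 < R ^ (1 / 2 + δ) := Real.rpow_pos_of_pos hR0 _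
      have hq := rpow_half_mul_self hR0
      have hq0 : 0 < R ^ (1 / 2 : ℝ) := Real.rpow_pos_of_pos hR0 _
      calc R + R ^ (1 / 2 + δ) ≤ X * R ^ (1 / 2 + δ) + X * R ^ (1 / 2 + δ) := by
            gcongr
            · calc R = R ^ (1 / 2 : ℝ) * R ^ (1 / 2 : ℝ) := hq.symm
                _ ≤ _ := by gcongr
            · nlinarith
        _ = 2 * X * R ^ (1 / 2 + δ) := by ring
        _ ≤ _ := by
          gcongr
          exact Nat.le_ceil _
    refine ⟨planeGrid (b 0) (inner ℝ a (b 0)) (R ^ (1 / 2 + δ)) ⌈2 * X⌉₊, ?_, ?_, ?_⟩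
    · intro H hH
      exact isPlane_of_mem_planeGrid (b.norm_eq_one 0) hH
    · calc ((planeGrid (b 0) (inner ℝ a (b 0)) (R ^ (1 / 2 + δ)) ⌈2 * X⌉₊).card : ℝ)
          ≤ ((2 * ⌈2 * X⌉₊ + 1 : ℕ) : ℝ) := by exact_mod_cast card_planeGrid_le _ _ _ _
        _ ≤ 7 * X := card_frame_cells_le hX
        _ = 7 * cellRatio d * (R ^ δ) ^ 5 := by rw [hXdef]; ring
        _ ≤ _ := by
          have : (0 : ℝ) ≤ 2 * ((7 * cellRatio d) ^ 3 * (cellPlaneBound d * 9)) := by positivity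
          gcongr
          · linarith
          · norm_num
    · rintro T hT ⟨-, T', -, ⟨x, ⟨hx, -⟩, -, hxa⟩, -⟩
      rw [Metric.mem_closedBall, dist_eq_norm] at hxa
      exact exists_planeGrid_of_meets_ball hR0 (b.norm_eq_one 0) hm (by rw [hT, ← hb]; exact h01)
        hx hxa

end
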